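/- Let $S=\{s_1,\dots,s_n\}$ be a set of $n$ pairwise disjoint closed line segments in $\mathbb{R}^2$ (a segment may degenerate to a point), in general position: no more than two endpoints lie on the same line, and no more than three segments touch the same circle, where $s$ touches the circle of centre $c$ and radius $\rho>0$ if $d(c,s)=\rho$. Here $d(x,s)=\min_{q\in s}\lVert x-q\rVert$. For $H\subset S$ with $|H|=k$ let $$V_k(H,S)=\{x\in\mathbb{R}^2 \mid d(x,s)<d(x,t)\ \text{for all } s\in H,\ t\in S\setminus H\}$$ be the order-$k$ Voronoi region of $H$. A vertex of the order-$k$ Voronoi diagram is a point in the closures of at least three different order-$k$ regions. An edge is a connected component of the set that remains of $\overline{V_k(H_1,S)}\cap\overline{V_k(H_2,S)}$, with $H_1\neq H_2$ and $|H_1|=|H_2|=k$, after all vertices are removed. Let $U_k$ be the number of unbounded edges of the order-$k$ Voronoi diagram, where an edge that is unbounded in both directions (that is, some point of it splits it into pieces of which two are unbounded) is counted twice. Then the total number of unbounded edges over all orders is $$\sum_{k=1}^{n-1}U_k=n(n-1).$$ -/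

import Mathlib

namespace SegVoronoi

/-- The Euclidean plane. -/
abbrev Plane : Type := EuclideanSpace ℝ (Fin 2)

/-- The family of line segments with endpoints `a i` and `b i`. -/
def sites {n : ℕ} (a b : Fin n → Plane) (i : Fin n) : Set Plane :=
  segment ℝ (a i) (b i)

/-- The segments are pairwise disjoint. -/
def DisjointSites {n : ℕ} (s : Fin n → Set Plane) : Prop :=
  Pairwise fun i j => Disjoint (s i) (s j)

/-- No more than two endpoints of the segments lie on the same line. -/
def NoThreeEndpointsCollinear {n : ℕ} (a b : Fin n → Plane) : Prop :=
  ∀ p ∈ Set.range a ∪ Set.range b, ∀ q ∈ Set.range a ∪ Set.range b,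
    ∀ r ∈ Set.range a ∪ Set.range b,
      p ≠ q → p ≠ r → q ≠ r → ¬ Collinear ℝ {p, q, r}

/-- No more than three sites touch the same circle: a site touches the circle of centre `c` and
radius `ρ` if its distance to `c` is exactly `ρ`. -/
def NoFourSitesOnCircle {n : ℕ} (s : Fin n → Set Plane) : Prop :=
  ∀ (c : Plane) (ρ : ℝ), 0 < ρ → {i | Metric.infDist c (s i) = ρ}.ncard ≤ 3

/-- The generalized Voronoi region of the sites with index in `H`: the points closer to every site
of `H` than to every other site. It is an order-`k` region if `H` has `k` elements. -/
def region {n : ℕ} (s : Fin n → Set Plane) (H : Finset (Fin n)) : Set Plane :=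
  {x | ∀ i ∈ H, ∀ j ∉ H, Metric.infDist x (s i) < Metric.infDist x (s j)}

/-- The vertices of the order-`k` Voronoi diagram: the points in the closures of at least three
order-`k` regions. -/
def vertices {n : ℕ} (s : Fin n → Set Plane) (k : ℕ) : Set Plane :=
  {x | ∃ A B C : Finset (Fin n), A.card = k ∧ B.card = k ∧ C.card = k ∧
    A ≠ B ∧ A ≠ C ∧ B ≠ C ∧
    x ∈ closure (region s A) ∧ x ∈ closure (region s B) ∧ x ∈ closure (region s C)}

/-- The common boundary of the order-`k` regions of `A` and `B`, without the vertices. -/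
def commonBoundary {n : ℕ} (s : Fin n → Set Plane) (k : ℕ) (A B : Finset (Fin n)) : Set Plane :=
  (closure (region s A) ∩ closure (region s B)) \ vertices s k

/-- The edges of the order-`k` Voronoi diagram: the connected components of the vertex-free common
boundaries of two different order-`k` regions. -/
def edges {n : ℕ} (s : Fin n → Set Plane) (k : ℕ) : Set (Set Plane) :=
  {e | ∃ A B : Finset (Fin n), A.card = k ∧ B.card = k ∧ A ≠ B ∧
    ∃ x ∈ commonBoundary s k A B, e = connectedComponentIn (commonBoundary s k A B) x}

/-- A curve `e` is unbounded in both directions if some point `x` of it splits it into pieces of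
which two different ones are unbounded. -/
def UnboundedInBothDirections (e : Set Plane) : Prop :=
  ∃ x ∈ e, ∃ y ∈ e \ {x}, ∃ z ∈ e \ {x},
    connectedComponentIn (e \ {x}) y ≠ connectedComponentIn (e \ {x}) z ∧
    ¬ Bornology.IsBounded (connectedComponentIn (e \ {x}) y) ∧
    ¬ Bornology.IsBounded (connectedComponentIn (e \ {x}) z)

/-- The number of unbounded edges of the order-`k` Voronoi diagram, where an edge that is unbounded
in both directions is counted twice. The value is in `ℕ∞`, so that it is meaningful before the
number of edges is known to be finite. -/
noncomputable def numUnboundedEdges {n : ℕ} (s : Fin n → Set Plane) (k : ℕ) : ℕ∞ :=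
  {e ∈ edges s k | ¬ Bornology.IsBounded e}.encard +
    {e ∈ edges s k | UnboundedInBothDirections e}.encard

end SegVoronoi

namespace SegVoronoi

/-! Write `h_s(u) = max_{q ∈ s} ⟪u, q⟫` for the support function of a segment. As `x` goes to
infinity in a unit direction `u`, `d(x, s) - ‖x‖` tends to `-h_s(u)`, so far away the segments are
ranked by distance in decreasing order of `h_s(u)` (`tendsto_infDist_segment_sub_norm`). Two
disjoint segments tie only along the normals of their two outer common tangents. An ordered pair
`(i, j)` selects one of these, the line through endpoints `p`, `q` with both segments on its left
(`IsSupportingPair`). Near its normal the two distances are exactly those to `p` and `q`, so outside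
a large ball the bisector is two straight rays, one for each order of the pair.

A third segment cannot share such a tangent, as three endpoints would be collinear. Hence the set `K
i j` of segments closer than `i` and `j` is constant along the far ray of `(i, j)`. That ray
separates exactly the regions of `insert i K` and `insert j K`, and so lies in an edge of the single
order `|K i j| + 1`, which is between `1` and `n - 1` (`exists_farStructure`,
`FarStructure.eq_insert_of_card`).

Conversely every far point of an edge lies on such a ray. One edge contains at most the rays of `(i,
j)` and `(j, i)`, and it is unbounded in both directions exactly when it contains both. With the
double count, `U_k` is therefore the number of ordered pairs of order `k`, and summing over `k`
counts all `n(n-1)` ordered pairs. -/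

open Filter Topology Bornology

/-! ### Coordinates and quarter turns in the plane -/

/-- Rotation of a vector by a quarter turn clockwise. -/
noncomputable def rotCW (v : Plane) : Plane := !₂[v 1, -v 0]

@[simp] lemma rotCW_zero_apply (v : Plane) : rotCW v 0 = v 1 := rfl

@[simp] lemma rotCW_one_apply (v : Plane) : rotCW v 1 = -v 0 := rfl

lemma inner_eq_coord (x y : Plane) : inner ℝ x y = x 0 * y 0 + x 1 * y 1 := by
  simp [PiLp.inner_apply, Fin.sum_univ_two, mul_comm]

lemma norm_sq_eq_coord (x : Plane) : ‖x‖ ^ 2 = x 0 ^ 2 + x 1 ^ 2 := by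
  rw [← real_inner_self_eq_norm_sq, inner_eq_coord]; ring

lemma plane_ext {x y : Plane} (h0 : x 0 = y 0) (h1 : x 1 = y 1) : x = y := by
  ext i; fin_cases i <;> assumption

lemma norm_rotCW (v : Plane) : ‖rotCW v‖ = ‖v‖ := by
  rw [← sq_eq_sq₀ (norm_nonneg _) (norm_nonneg _), norm_sq_eq_coord, norm_sq_eq_coord]
  simp; ring

lemma rotCW_neg (v : Plane) : rotCW (-v) = -rotCW v := by
  apply plane_ext <;> simp

lemma inner_rotCW_self (v : Plane) : inner ℝ v (rotCW v) = 0 := by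
  rw [inner_eq_coord]; simp; ring

/-- A vector orthogonal to a nonzero `v` is a multiple of the rotated vector. -/
lemma eq_smul_rotCW {x v : Plane} (hv : v ≠ 0) (h : inner ℝ x v = 0) :
    x = (inner ℝ x (rotCW v) / ‖v‖ ^ 2) • rotCW v := by
  have hv2 : ‖v‖ ^ 2 ≠ 0 := by simpa using hv
  rw [inner_eq_coord] at h
  rw [norm_sq_eq_coord] at *
  apply plane_ext <;> simp [inner_eq_coord] <;> field_simp
  · linear_combination (v 0) * h
  · linear_combination (v 1) * h

/-- Three points on a line with normal vector `u` are collinear. -/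
lemma collinear_of_inner_eq {u p q r : Plane} (hu : u ≠ 0) (hq : inner ℝ q u = inner ℝ p u)
    (hr : inner ℝ r u = inner ℝ p u) : Collinear ℝ {p, q, r} := by
  rw [collinear_iff_of_mem (p₀ := p) (by simp)]
  have key : ∀ x : Plane, inner ℝ x u = inner ℝ p u → ∃ t : ℝ, x = t • rotCW u +ᵥ p := by
    intro x hx
    refine ⟨inner ℝ (x - p) (rotCW u) / ‖u‖ ^ 2, ?_⟩
    rw [← eq_smul_rotCW hu (x := x - p) (by rw [inner_sub_left, hx, sub_self])]
    simp
  refine ⟨rotCW u, ?_⟩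
  simp only [Set.mem_insert_iff, Set.mem_singleton_iff, forall_eq_or_imp, forall_eq]
  exact ⟨key p rfl, key q hq, key r hr⟩

/-! ### Outer common tangents of two disjoint segments -/

/-- The directed line from the endpoint `p` of the segment `ab` to the endpoint `q` of the segment
`cd` has both segments on its left. -/
structure IsSupportingPair (a b c d p q : Plane) : Prop where
  left : p = a ∨ p = b
  right : q = c ∨ q = d
  le : ∀ r, r = a ∨ r = b ∨ r = c ∨ r = d →
    inner ℝ r (rotCW (q - p)) ≤ inner ℝ p (rotCW (q - p))

lemma mem_segment_of_eq_or_eq {a b p : Plane} (hp : p = a ∨ p = b) : p ∈ segment ℝ a b := by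
  rcases hp with rfl | rfl
  exacts [left_mem_segment _ _ _, right_mem_segment _ _ _]

lemma endpoint_ne_of_disjoint {a b c d p q : Plane}
    (h : Disjoint (segment ℝ a b) (segment ℝ c d)) (hp : p = a ∨ p = b) (hq : q = c ∨ q = d) :
    p ≠ q := by
  rintro rfl
  exact Set.disjoint_left.1 h (mem_segment_of_eq_or_eq hp) (mem_segment_of_eq_or_eq hq)

/-- A linear functional that separates two disjoint segments. -/
lemma exists_separating_coord {a b c d : Plane}
    (h : Disjoint (segment ℝ a b) (segment ℝ c d)) :
    ∃ (e : Plane) (γ : ℝ), (∀ p, p = a ∨ p = b → inner ℝ p e < γ) ∧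
      ∀ q, q = c ∨ q = d → γ < inner ℝ q e := by
  have hc : ∀ x y : Plane, IsCompact (segment ℝ x y) := fun x y => by
    rw [← convexHull_pair]; exact (Set.toFinite _).isCompact_convexHull ℝ
  obtain ⟨f, u, v, hu, huv, hv⟩ := geometric_hahn_banach_compact_closed (convex_segment a b)
    (hc a b) (convex_segment c d) (hc c d).isClosed h
  refine ⟨(InnerProductSpace.toDual ℝ Plane).symm f, u, ?_, ?_⟩
  · rintro p hp
    rw [real_inner_comm, InnerProductSpace.toDual_symm_apply]
    exact hu _ (mem_segment_of_eq_or_eq hp)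
  · rintro p hp
    rw [real_inner_comm, InnerProductSpace.toDual_symm_apply]
    exact huv.trans (hv _ (mem_segment_of_eq_or_eq hp))

/-- The height at which the line through `p` and `q` meets the line `⟪x, e⟫ = γ`. -/
noncomputable def crossHeight (e : Plane) (γ : ℝ) (p q : Plane) : ℝ :=
  (inner ℝ q (rotCW e) * (inner ℝ p e - γ) - inner ℝ p (rotCW e) * (inner ℝ q e - γ)) /
    (inner ℝ q e - inner ℝ p e)

/-- Height is measured along `-rotCW e`, so "higher" means "further left" for a traveller crossing
in direction `e`. With `q` fixed, clearing denominators turns the comparison of heights into the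
orientation inequality times `‖e‖² (⟪q, e⟫ - γ) > 0`. -/
lemma crossHeight_le_left {e p q r : Plane} {γ : ℝ} (hp : inner ℝ p e < γ) (hq : γ < inner ℝ q e)
    (hr : inner ℝ r e < γ) (h : crossHeight e γ p q ≤ crossHeight e γ r q) :
    inner ℝ r (rotCW (q - p)) ≤ inner ℝ p (rotCW (q - p)) := by
  unfold crossHeight at h
  rw [div_le_div_iff₀ (by linarith) (by linarith)] at h
  have he : 0 < ‖e‖ ^ 2 := by
    have : e ≠ 0 := by rintro rfl; simp at hp hq; linarith
    positivity
  rw [norm_sq_eq_coord] at he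
  simp only [inner_eq_coord, rotCW_zero_apply, rotCW_one_apply, PiLp.sub_apply] at *
  have hpos : 0 < (e 0 ^ 2 + e 1 ^ 2) * (q 0 * e 0 + q 1 * e 1 - γ) := mul_pos he (by linarith)
  refine le_of_mul_le_mul_left ?_ hpos
  nlinarith [h]

lemma crossHeight_le_right {e p q r : Plane} {γ : ℝ} (hp : inner ℝ p e < γ)
    (hq : γ < inner ℝ q e) (hr : γ < inner ℝ r e)
    (h : crossHeight e γ p q ≤ crossHeight e γ p r) :
    inner ℝ r (rotCW (q - p)) ≤ inner ℝ p (rotCW (q - p)) := by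
  unfold crossHeight at h
  rw [div_le_div_iff₀ (by linarith) (by linarith)] at h
  have he : 0 < ‖e‖ ^ 2 := by
    have : e ≠ 0 := by rintro rfl; simp at hp hq; linarith
    positivity
  rw [norm_sq_eq_coord] at he
  simp only [inner_eq_coord, rotCW_zero_apply, rotCW_one_apply, PiLp.sub_apply] at *
  have hpos : 0 < (e 0 ^ 2 + e 1 ^ 2) * (γ - (p 0 * e 0 + p 1 * e 1)) := mul_pos he (by linarith)
  refine le_of_mul_le_mul_left ?_ hpos
  nlinarith [h]

/-- Points to the left of the line through `p` and `q` span lines that meet the separating line at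
a greater height. -/
lemma crossHeight_sub_eq {e p q p' q' : Plane} {γ : ℝ} (hp : inner ℝ p e < γ)
    (hq : γ < inner ℝ q e) (hp' : inner ℝ p' e < γ) (hq' : γ < inner ℝ q' e) :
    (inner ℝ q' e - γ) * (inner ℝ p (rotCW (q - p)) - inner ℝ p' (rotCW (q - p))) +
      (γ - inner ℝ p' e) * (inner ℝ p (rotCW (q - p)) - inner ℝ q' (rotCW (q - p))) =
    (crossHeight e γ p' q' - crossHeight e γ p q) *
      ((inner ℝ q e - inner ℝ p e) * (inner ℝ q' e - inner ℝ p' e) / ‖e‖ ^ 2) := by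
  have he : ‖e‖ ^ 2 ≠ 0 := by
    have : e ≠ 0 := by rintro rfl; simp at hp hq; linarith
    positivity
  have h1 : inner ℝ q e - inner ℝ p e ≠ 0 := by linarith
  have h2 : inner ℝ q' e - inner ℝ p' e ≠ 0 := by linarith
  rw [mul_div_assoc', eq_div_iff he]
  have k1 : crossHeight e γ p q * (inner ℝ q e - inner ℝ p e) = _ := div_mul_cancel₀ _ h1
  have k2 : crossHeight e γ p' q' * (inner ℝ q' e - inner ℝ p' e) = _ := div_mul_cancel₀ _ h2
  trans (crossHeight e γ p' q' * (inner ℝ q' e - inner ℝ p' e)) * (inner ℝ q e - inner ℝ p e) -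
    (crossHeight e γ p q * (inner ℝ q e - inner ℝ p e)) * (inner ℝ q' e - inner ℝ p' e)
  · rw [k1, k2, norm_sq_eq_coord]
    simp only [inner_eq_coord, rotCW_zero_apply, rotCW_one_apply, PiLp.sub_apply]
    ring
  · ring

/-- Among the four lines joining an endpoint of `ab` to one of `cd`, take one that crosses a
separating line lowest. An endpoint strictly to its right would give a lower crossing. -/
lemma exists_isSupportingPair {a b c d : Plane}
    (h : Disjoint (segment ℝ a b) (segment ℝ c d)) : ∃ p q, IsSupportingPair a b c d p q := by
  classical
  obtain ⟨e, γ, hl, hr⟩ := exists_separating_coord h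
  obtain ⟨⟨p, q⟩, hpq, hmin⟩ := Finset.exists_min_image (({a, b} : Finset Plane) ×ˢ {c, d})
    (fun z => crossHeight e γ z.1 z.2) ⟨(a, c), by simp⟩
  simp only [Finset.mem_product, Finset.mem_insert, Finset.mem_singleton] at hpq hmin
  refine ⟨p, q, hpq.1, hpq.2, fun r h => ?_⟩
  rw [← or_assoc] at h
  rcases h with h | h
  · exact crossHeight_le_left (hl p hpq.1) (hr q hpq.2) (hl r h) (hmin (r, q) ⟨h, hpq.2⟩)
  · exact crossHeight_le_right (hl p hpq.1) (hr q hpq.2) (hr r h) (hmin (p, r) ⟨hpq.1, h⟩)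

lemma inner_rotCW_right (p q : Plane) :
    inner ℝ q (rotCW (q - p)) = inner ℝ p (rotCW (q - p)) := by
  have := inner_rotCW_self (q - p)
  rw [inner_sub_left] at this
  linarith

/-- Two supporting pairs lie on a common line. -/
lemma IsSupportingPair.inner_eq {a b c d p q p' q' : Plane}
    (h : Disjoint (segment ℝ a b) (segment ℝ c d)) (hpq : IsSupportingPair a b c d p q)
    (hpq' : IsSupportingPair a b c d p' q') :
    inner ℝ p' (rotCW (q - p)) = inner ℝ p (rotCW (q - p)) ∧
      inner ℝ q' (rotCW (q - p)) = inner ℝ p (rotCW (q - p)) := by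
  obtain ⟨e, γ, hl, hr⟩ := exists_separating_coord h
  have hp := hl p hpq.left
  have hq := hr q hpq.right
  have hp' := hl p' hpq'.left
  have hq' := hr q' hpq'.right
  have he : 0 < ‖e‖ ^ 2 := by
    have : e ≠ 0 := by rintro rfl; simp at hp hq; linarith
    positivity
  -- The two identities have opposite right sides, while their left sides are sums of nonnegative
  -- terms, so every term vanishes.
  have h1 := crossHeight_sub_eq hp hq hp' hq'
  have h2 := crossHeight_sub_eq hp' hq' hp hq
  have hD : 0 < (inner ℝ q e - inner ℝ p e) * (inner ℝ q' e - inner ℝ p' e) / ‖e‖ ^ 2 :=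
    div_pos (mul_pos (by linarith) (by linarith)) he
  rw [mul_comm (inner ℝ q' e - inner ℝ p' e)] at h2
  have mem : ∀ {x y : Plane}, x = a ∨ x = b → y = c ∨ y = d →
      (x = a ∨ x = b ∨ x = c ∨ x = d) ∧ (y = a ∨ y = b ∨ y = c ∨ y = d) := by tauto
  have m := mem hpq.left hpq.right
  have m' := mem hpq'.left hpq'.right
  have a1 := mul_nonneg (sub_pos.2 hq').le (sub_nonneg.2 (hpq.le p' m'.1))
  have a2 := mul_nonneg (sub_pos.2 hp').le (sub_nonneg.2 (hpq.le q' m'.2))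
  have a3 := mul_nonneg (sub_pos.2 hq).le (sub_nonneg.2 (hpq'.le p m.1))
  have a4 := mul_nonneg (sub_pos.2 hp).le (sub_nonneg.2 (hpq'.le q m.2))
  have b1 : (inner ℝ q' e - γ) * (inner ℝ p (rotCW (q - p)) - inner ℝ p' (rotCW (q - p))) = 0 := by
    linarith
  have b2 : (γ - inner ℝ p' e) * (inner ℝ p (rotCW (q - p)) - inner ℝ q' (rotCW (q - p))) = 0 := by
    linarith
  have c1 := (mul_eq_zero.1 b1).resolve_left (by linarith)
  have c2 := (mul_eq_zero.1 b2).resolve_left (by linarith)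
  exact ⟨by linarith, by linarith⟩

/-- No three distinct points among the endpoints of two segments are collinear. -/
def NoThreeCollinear (a b c d : Plane) : Prop :=
  ∀ x y z, (x = a ∨ x = b ∨ x = c ∨ x = d) → (y = a ∨ y = b ∨ y = c ∨ y = d) →
    (z = a ∨ z = b ∨ z = c ∨ z = d) → x ≠ y → x ≠ z → y ≠ z → ¬ Collinear ℝ {x, y, z}

lemma NoThreeCollinear.symm {a b c d : Plane} (h : NoThreeCollinear a b c d) :
    NoThreeCollinear c d a b := fun x y z hx hy hz =>
  h x y z (by tauto) (by tauto) (by tauto)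

/-- Both pairs lie on one line, and endpoints of different segments differ. A second choice of `p`
or of `q` would be a third endpoint on that line. -/
lemma IsSupportingPair.unique {a b c d p q p' q' : Plane}
    (h : Disjoint (segment ℝ a b) (segment ℝ c d))
    (hcol : NoThreeCollinear a b c d)
    (hpq : IsSupportingPair a b c d p q) (hpq' : IsSupportingPair a b c d p' q') :
    p = p' ∧ q = q' := by
  have hne : ∀ x y : Plane, x = a ∨ x = b → y = c ∨ y = d → x ≠ y := fun x y =>
    endpoint_ne_of_disjoint h
  obtain ⟨h1, h2⟩ := hpq.inner_eq h hpq'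
  have hu : rotCW (q - p) ≠ 0 := by
    rw [← norm_ne_zero_iff, norm_rotCW, norm_ne_zero_iff, sub_ne_zero]
    exact (hne _ _ hpq.left hpq.right).symm
  have hl := hpq.left
  have hr := hpq.right
  have hl' := hpq'.left
  have hr' := hpq'.right
  constructor
  · by_contra hp
    exact hcol p p' q (by tauto) (by tauto) (by tauto) hp (hne _ _ hl hr) (hne _ _ hl' hr)
      (collinear_of_inner_eq hu h1 (inner_rotCW_right p q))
  · by_contra hq
    exact hcol p q q' (by tauto) (by tauto) (by tauto) (hne _ _ hl hr) (hne _ _ hl hr') hq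
      (collinear_of_inner_eq hu (inner_rotCW_right p q) h2)

/-! ### Going to infinity in a direction -/

/-- The filter of points that go to infinity in the direction `u`. -/
noncomputable def directionFilter (u : Plane) : Filter Plane :=
  cobounded Plane ⊓ comap (fun x => ‖x‖⁻¹ • x) (𝓝 u)

lemma tendsto_normalize (u : Plane) :
    Tendsto (fun x : Plane => ‖x‖⁻¹ • x) (directionFilter u) (𝓝 u) :=
  tendsto_comap.mono_left inf_le_right

lemma tendsto_norm_directionFilter (u : Plane) :
    Tendsto (fun x : Plane => ‖x‖) (directionFilter u) atTop :=
  tendsto_norm_cobounded_atTop.mono_left inf_le_left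

lemma eventually_ne_zero_directionFilter (u : Plane) :
    ∀ᶠ x in directionFilter u, 0 < ‖x‖ :=
  (tendsto_norm_directionFilter u).eventually_gt_atTop 0

/-- Compactness of the circle of directions. -/
lemma eventually_cobounded_of_directionFilter {P : Plane → Prop}
    (h : ∀ u : Plane, ‖u‖ = 1 → ∀ᶠ x in directionFilter u, P x) :
    ∀ᶠ x in cobounded Plane, P x := by
  have key : ∀ᶠ x in cobounded Plane, ‖x‖⁻¹ • x ∈ Metric.sphere (0 : Plane) 1 → P x := by
    refine IsCompact.induction_on (isCompact_sphere (0 : Plane) 1)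
      (p := fun s => ∀ᶠ x in cobounded Plane, ‖x‖⁻¹ • x ∈ s → P x) (by simp) ?_ ?_ ?_
    · intro s t hst ht
      filter_upwards [ht] with x hx hs using hx (hst hs)
    · intro s t hs ht
      filter_upwards [hs, ht] with x hxs hxt hx using hx.elim hxs hxt
    · intro u hu
      have := h u (by simpa using hu)
      rw [directionFilter, eventually_inf] at this
      obtain ⟨s, hs, t, ht, hst⟩ := this
      obtain ⟨v, hv, hvt⟩ := mem_comap.1 ht
      refine ⟨v, mem_nhdsWithin_of_mem_nhds hv, ?_⟩
      filter_upwards [hs] with x hx hxv using hst x ⟨hx, hvt hxv⟩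
  filter_upwards [key, tendsto_norm_cobounded_atTop.eventually_gt_atTop 0] with x hx hpos
  apply hx
  simp [norm_smul, hpos.ne']

lemma tendsto_inner_div_norm (u p : Plane) :
    Tendsto (fun x : Plane => ‖x‖⁻¹ * inner ℝ x p) (directionFilter u) (𝓝 (inner ℝ u p)) := by
  have := (tendsto_normalize u).inner (tendsto_const_nhds (x := p)) (𝕜 := ℝ)
  simpa [inner_smul_left] using this

lemma tendsto_inv_norm (u : Plane) :
    Tendsto (fun x : Plane => ‖x‖⁻¹) (directionFilter u) (𝓝 0) :=
  tendsto_inv_atTop_zero.comp (tendsto_norm_directionFilter u)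

/-- The sign of an affine function at infinity. -/
lemma eventually_inner_sub_neg {u v : Plane} (p : Plane) (h : inner ℝ u v < 0) :
    ∀ᶠ x in directionFilter u, inner ℝ (x - p) v < 0 := by
  have h1 : Tendsto (fun x : Plane => ‖x‖⁻¹ * inner ℝ x v - ‖x‖⁻¹ * inner ℝ p v)
      (directionFilter u) (𝓝 (inner ℝ u v - 0 * inner ℝ p v)) :=
    (tendsto_inner_div_norm u v).sub ((tendsto_inv_norm u).mul_const _)
  filter_upwards [h1.eventually_lt_const (by simpa using h),
    eventually_ne_zero_directionFilter u] with x hx hpos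
  rw [← mul_sub, ← inner_sub_left] at hx
  exact (pos_iff_neg_of_mul_neg hx).1 (inv_pos.2 hpos)

/-- Rationalise: `‖x - p‖ - ‖x‖ = (‖p‖² - 2⟪x, p⟫) / (‖x - p‖ + ‖x‖)`, then divide numerator and
denominator by `‖x‖`. -/
lemma tendsto_dist_sub_norm {u : Plane} (hu : ‖u‖ = 1) (p : Plane) :
    Tendsto (fun x : Plane => dist x p - ‖x‖) (directionFilter u) (𝓝 (-inner ℝ u p)) := by
  have h0 : Tendsto (fun x : Plane => ‖‖x‖⁻¹ • x - ‖x‖⁻¹ • p‖) (directionFilter u) (𝓝 1) := by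
    have := ((tendsto_normalize u).sub ((tendsto_inv_norm u).smul_const p)).norm
    simpa [hu] using this
  have h1 : Tendsto (fun x : Plane => (‖x‖⁻¹ * ‖p‖ ^ 2 - 2 * (‖x‖⁻¹ * inner ℝ x p)) /
      (‖‖x‖⁻¹ • x - ‖x‖⁻¹ • p‖ + 1)) (directionFilter u)
      (𝓝 ((0 * ‖p‖ ^ 2 - 2 * inner ℝ u p) / (1 + 1))) :=
    (((tendsto_inv_norm u).mul_const _).sub ((tendsto_inner_div_norm u p).const_mul 2)).div
      (h0.add_const 1) (by norm_num)
  have e : (0 * ‖p‖ ^ 2 - 2 * inner ℝ u p) / (1 + 1) = -inner ℝ u p := by ring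
  rw [e] at h1
  refine h1.congr' ?_
  filter_upwards [eventually_ne_zero_directionFilter u] with x hx
  rw [← smul_sub, norm_smul, norm_inv, norm_norm, dist_eq_norm]
  have h2 : ‖x - p‖ ^ 2 = ‖x‖ ^ 2 - 2 * inner ℝ x p + ‖p‖ ^ 2 := norm_sub_sq_real x p
  have h3 : 0 ≤ ‖x - p‖ := norm_nonneg _
  have h4 : ‖x‖⁻¹ * ‖x - p‖ + 1 ≠ 0 := by positivity
  rw [div_eq_iff h4]
  field_simp
  linear_combination -h2

/-! ### Support functions and the ranking of segments at infinity -/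

/-- The support function of the segment `ab`. -/
noncomputable def supportFn (a b u : Plane) : ℝ := max (inner ℝ u a) (inner ℝ u b)

/-- The segment lies in the half-plane `⟪v, ·⟫ ≤ supportFn a b v` for `v = x / ‖x‖`, and projecting
onto `v` cannot increase distances. -/
lemma norm_sub_supportFn_le (a b x : Plane) (hx : x ≠ 0) :
    ‖x‖ - supportFn a b (‖x‖⁻¹ • x) ≤ Metric.infDist x (segment ℝ a b) := by
  refine (Metric.le_infDist ⟨a, left_mem_segment _ _ _⟩).2 fun y hy => ?_
  have hx' : 0 < ‖x‖ := norm_pos_iff.2 hx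
  obtain ⟨s, t, hs, ht, hst, rfl⟩ := hy
  have h1 : inner ℝ (‖x‖⁻¹ • x) (s • a + t • b) ≤ supportFn a b (‖x‖⁻¹ • x) := by
    rw [inner_add_right, inner_smul_right, inner_smul_right]
    have ha : inner ℝ (‖x‖⁻¹ • x) a ≤ supportFn a b (‖x‖⁻¹ • x) := le_max_left _ _
    have hb : inner ℝ (‖x‖⁻¹ • x) b ≤ supportFn a b (‖x‖⁻¹ • x) := le_max_right _ _
    calc _ ≤ s * supportFn a b (‖x‖⁻¹ • x) + t * supportFn a b (‖x‖⁻¹ • x) := by gcongr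
      _ = _ := by rw [← add_mul, hst, one_mul]
  have h2 : inner ℝ (‖x‖⁻¹ • x) (x - (s • a + t • b)) ≤ ‖x - (s • a + t • b)‖ := by
    refine (real_inner_le_norm _ _).trans ?_
    simp [norm_smul, hx'.ne']
  rw [inner_sub_right] at h2
  have h3 : inner ℝ (‖x‖⁻¹ • x) x = ‖x‖ := by
    rw [real_inner_smul_left, real_inner_self_eq_norm_sq]; field_simp
  rw [dist_eq_norm]
  linarith

/-- Squeezed between the half-plane bound and the smaller of the two endpoint distances, which have
the same limit. -/
lemma tendsto_infDist_segment_sub_norm {u : Plane} (hu : ‖u‖ = 1) (a b : Plane) :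
    Tendsto (fun x : Plane => Metric.infDist x (segment ℝ a b) - ‖x‖) (directionFilter u)
      (𝓝 (-supportFn a b u)) := by
  have hc : Continuous (supportFn a b) := by unfold supportFn; fun_prop
  have hlow := ((hc.tendsto u).comp (tendsto_normalize u)).neg
  have hup := (tendsto_dist_sub_norm hu a).min (tendsto_dist_sub_norm hu b)
  rw [min_neg_neg] at hup
  refine tendsto_of_tendsto_of_tendsto_of_le_of_le' hlow hup ?_ ?_
  · filter_upwards [eventually_ne_zero_directionFilter u] with x hx
    have := norm_sub_supportFn_le a b x (norm_pos_iff.1 hx)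
    simp only [Function.comp_apply]
    linarith
  · refine Eventually.of_forall fun x => le_min ?_ ?_
    · exact sub_le_sub_right (Metric.infDist_le_dist_of_mem (left_mem_segment _ _ _)) _
    · exact sub_le_sub_right (Metric.infDist_le_dist_of_mem (right_mem_segment _ _ _)) _

lemma eventually_infDist_lt_of_supportFn_lt {u : Plane} (hu : ‖u‖ = 1) {a b c d : Plane}
    (h : supportFn c d u < supportFn a b u) :
    ∀ᶠ x in directionFilter u,
      Metric.infDist x (segment ℝ a b) < Metric.infDist x (segment ℝ c d) := by
  filter_upwards [(tendsto_infDist_segment_sub_norm hu a b).eventually_lt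
    (tendsto_infDist_segment_sub_norm hu c d) (neg_lt_neg h)] with x hx
  linarith

/-- The endpoint `p` is the point of `pp'` closest to `x`. -/
lemma infDist_segment_eq_dist {p p' x : Plane} (h : inner ℝ (x - p) (p' - p) ≤ 0) :
    Metric.infDist x (segment ℝ p p') = dist x p := by
  refine le_antisymm (Metric.infDist_le_dist_of_mem (left_mem_segment _ _ _)) ?_
  refine (Metric.le_infDist ⟨p, left_mem_segment _ _ _⟩).2 fun y hy => ?_
  rw [segment_eq_image'] at hy
  obtain ⟨t, ht, rfl⟩ := hy
  rw [dist_eq_norm, dist_eq_norm, ← sub_sub,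
    ← sq_le_sq₀ (norm_nonneg _) (norm_nonneg _), norm_sub_sq_real (x - p), inner_smul_right]
  nlinarith [mul_nonneg ht.1 (neg_nonneg.2 h), sq_nonneg ‖t • (p' - p)‖]

/-- If `p` is the strict maximum of `⟪u, ·⟫` on the segment, then eventually `⟪x - p, p' - p⟫ < 0`.
This is an open condition, so the equality holds on a neighbourhood, as is needed to transfer
statements about points near `x`. -/
lemma eventually_infDist_segment_eq_dist {u a b p : Plane} (hp : p = a ∨ p = b)
    (h : ∀ r, r = a ∨ r = b → r ≠ p → inner ℝ u r < inner ℝ u p) :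
    ∀ᶠ x in directionFilter u, ∀ᶠ y in 𝓝 x,
      Metric.infDist y (segment ℝ a b) = dist y p := by
  obtain ⟨p', hp', hseg⟩ : ∃ p', (p' = a ∨ p' = b) ∧ segment ℝ a b = segment ℝ p p' := by
    rcases hp with rfl | rfl
    · exact ⟨b, .inr rfl, rfl⟩
    · exact ⟨a, .inl rfl, segment_symm _ _ _⟩
  rw [hseg]
  by_cases hpp : p' = p
  · subst hpp
    simp
  · filter_upwards [eventually_inner_sub_neg (v := p' - p) p
      (by rw [inner_sub_right]; linarith [h p' hp' hpp])] with x hx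
    have hc : Continuous fun y : Plane => inner ℝ (y - p) (p' - p) := by fun_prop
    filter_upwards [hc.tendsto x |>.eventually_lt_const hx] with y hy
    exact infDist_segment_eq_dist hy.le

/-- Far points of a ray with direction `w` have direction close to `w`. -/
lemma eventually_ray_of_directionFilter {m w : Plane} (hw : ‖w‖ = 1) {P : Plane → Prop}
    (h : ∀ᶠ x in directionFilter w, P x) :
    ∀ᶠ x in cobounded Plane, (∃ t : ℝ, 0 < t ∧ x = m + t • w) → P x := by
  have hle : cobounded Plane ⊓ 𝓟 {x | ∃ t : ℝ, 0 < t ∧ x = m + t • w} ≤ directionFilter w := by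
    refine le_inf inf_le_left (tendsto_iff_comap.1 ?_)
    rw [tendsto_iff_dist_tendsto_zero]
    -- The factor 2 collects `‖m‖` itself and `|t - ‖x‖| ≤ ‖m‖` in `‖x‖⁻¹ • x - w = ‖x‖⁻¹ • (m + (t
    -- - ‖x‖) • w)`.
    have h0 : Tendsto (fun x : Plane => 2 * ‖m‖ * ‖x‖⁻¹)
        (cobounded Plane ⊓ 𝓟 {x | ∃ t : ℝ, 0 < t ∧ x = m + t • w}) (𝓝 0) := by
      have := (tendsto_inv_atTop_zero.comp
        (tendsto_norm_cobounded_atTop (E := Plane))).const_mul (2 * ‖m‖)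
      rw [mul_zero] at this
      exact this.mono_left inf_le_left
    refine squeeze_zero' (Eventually.of_forall fun _ => dist_nonneg) ?_ h0
    rw [eventually_inf_principal]
    filter_upwards [tendsto_norm_cobounded_atTop.eventually_gt_atTop 0]
    rintro x hx ⟨t, ht, hxt⟩
    have h1 : ‖x‖⁻¹ • x - w = ‖x‖⁻¹ • (m + (t - ‖x‖) • w) := by
      have : x = m + t • w := hxt
      rw [sub_smul, ← add_sub_assoc, ← this, smul_sub, smul_smul, inv_mul_cancel₀ hx.ne', one_smul]
    have h2 : |t - ‖x‖| ≤ ‖m‖ := by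
      have h3 := abs_norm_sub_norm_le (t • w) x
      rw [norm_smul, hw, mul_one, Real.norm_eq_abs, abs_of_pos ht] at h3
      refine h3.trans_eq ?_
      rw [hxt, sub_add_cancel_right, norm_neg]
    rw [dist_eq_norm, h1, norm_smul, norm_inv, norm_norm, mul_comm]
    gcongr
    refine (norm_add_le _ _).trans ?_
    rw [norm_smul, hw, mul_one, Real.norm_eq_abs]
    linarith
  exact eventually_inf_principal.1 (h.filter_mono hle)

/-! ### Tangent normals and the rays of a bisector -/

/-- The unit vector that is normal to the directed line from `p` to `q` and points to its right. -/
noncomputable def unitNormal (p q : Plane) : Plane := ‖q - p‖⁻¹ • rotCW (q - p)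

lemma norm_unitNormal {p q : Plane} (h : p ≠ q) : ‖unitNormal p q‖ = 1 := by
  have : ‖q - p‖ ≠ 0 := norm_ne_zero_iff.2 (sub_ne_zero.2 h.symm)
  rw [unitNormal, norm_smul, norm_rotCW, norm_inv, norm_norm, inv_mul_cancel₀ this]

lemma unitNormal_swap (p q : Plane) : unitNormal q p = -unitNormal p q := by
  rw [unitNormal, unitNormal, ← neg_sub q p, rotCW_neg, norm_neg, smul_neg]

lemma inner_unitNormal_right (p q : Plane) :
    inner ℝ (unitNormal p q) q = inner ℝ (unitNormal p q) p := by
  rw [unitNormal, real_inner_smul_left, real_inner_smul_left, real_inner_comm,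
    inner_rotCW_right, real_inner_comm]

/-- A point of the perpendicular bisector of `p` and `q`. -/
lemma eq_midpoint_add_of_dist_eq {p q x : Plane} (h : p ≠ q) (hx : dist x p = dist x q) :
    x = midpoint ℝ p q + (inner ℝ (x - midpoint ℝ p q) (unitNormal p q)) • unitNormal p q := by
  have hqp : q - p ≠ 0 := sub_ne_zero.2 h.symm
  have h0 : inner ℝ (x - midpoint ℝ p q) (q - p) = 0 := by
    have := AffineSubspace.mem_perpBisector_iff_dist_eq.2 hx
    rw [AffineSubspace.mem_perpBisector_iff_inner_eq_zero] at this
    exact this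
  have h1 := eq_smul_rotCW hqp h0
  rw [unitNormal, inner_smul_right, smul_smul, ← sub_eq_iff_eq_add']
  refine h1.trans ?_
  congr 1
  ring

lemma dist_eq_of_eq_midpoint_add {p q x : Plane} {t : ℝ}
    (hx : x = midpoint ℝ p q + t • unitNormal p q) : dist x p = dist x q := by
  rw [← AffineSubspace.mem_perpBisector_iff_dist_eq,
    AffineSubspace.mem_perpBisector_iff_inner_eq_zero, hx]
  simp only [vsub_eq_sub, add_sub_cancel_left]
  rw [inner_smul_left, inner_sub_right, inner_unitNormal_right, sub_self, mul_zero]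

/-- Any point of the bisector is a limit of points closer to `p`. -/
lemma mem_closure_dist_lt {p q x : Plane} (h : p ≠ q) (hx : dist x p = dist x q) :
    ∃ᶠ y in 𝓝 x, dist y p < dist y q := by
  have ht : Tendsto (fun ε : ℝ => x + ε • (p - q)) (𝓝[>] 0) (𝓝 x) := by
    have hc : Continuous fun ε : ℝ => x + ε • (p - q) := by fun_prop
    simpa using (hc.tendsto 0).mono_left nhdsWithin_le_nhds
  refine ht.frequently (Eventually.frequently ?_)
  filter_upwards [self_mem_nhdsWithin] with ε hε
  have hε : 0 < ε := hε
  have hpq : 0 < ‖p - q‖ ^ 2 := by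
    have := norm_pos_iff.2 (sub_ne_zero.2 h); positivity
  rw [dist_eq_norm, dist_eq_norm, ← sq_lt_sq₀ (norm_nonneg _) (norm_nonneg _)]
  rw [dist_eq_norm, dist_eq_norm, ← sq_eq_sq₀ (norm_nonneg _) (norm_nonneg _)] at hx
  rw [norm_sq_eq_coord] at *
  simp only [norm_sq_eq_coord, PiLp.sub_apply, PiLp.add_apply, PiLp.smul_apply, smul_eq_mul] at *
  nlinarith [mul_pos hε hpq]

section Pair

variable {a b c d p q : Plane}

lemma IsSupportingPair.ne (h : Disjoint (segment ℝ a b) (segment ℝ c d))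
    (hpq : IsSupportingPair a b c d p q) : p ≠ q :=
  endpoint_ne_of_disjoint h hpq.left hpq.right

lemma IsSupportingPair.inner_le (hpq : IsSupportingPair a b c d p q) (r : Plane)
    (hr : r = a ∨ r = b ∨ r = c ∨ r = d) :
    inner ℝ (unitNormal p q) r ≤ inner ℝ (unitNormal p q) p := by
  rw [unitNormal, real_inner_smul_left, real_inner_smul_left, real_inner_comm,
    real_inner_comm p]
  exact mul_le_mul_of_nonneg_left (hpq.le r hr) (by positivity)

lemma IsSupportingPair.supportFn_left (hpq : IsSupportingPair a b c d p q) :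
    supportFn a b (unitNormal p q) = inner ℝ (unitNormal p q) p := by
  refine le_antisymm (max_le (hpq.inner_le a (by simp)) (hpq.inner_le b (by simp))) ?_
  rcases hpq.left with rfl | rfl
  exacts [le_max_left _ _, le_max_right _ _]

lemma IsSupportingPair.supportFn_right (hpq : IsSupportingPair a b c d p q) :
    supportFn c d (unitNormal p q) = inner ℝ (unitNormal p q) p := by
  refine le_antisymm (max_le (hpq.inner_le c (by simp)) (hpq.inner_le d (by simp))) ?_
  rw [← inner_unitNormal_right]
  rcases hpq.right with rfl | rfl
  exacts [le_max_left _ _, le_max_right _ _]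

lemma unitNormal_ne_zero (h : p ≠ q) : unitNormal p q ≠ 0 := by
  rw [← norm_ne_zero_iff, norm_unitNormal h]; exact one_ne_zero

/-- Near the direction of the normal, the distances to the two segments are the distances to the
supporting pair. -/
lemma IsSupportingPair.eventually_infDist_eq (h : Disjoint (segment ℝ a b) (segment ℝ c d))
    (hcol : NoThreeCollinear a b c d) (hpq : IsSupportingPair a b c d p q) :
    ∀ᶠ x in directionFilter (unitNormal p q), ∀ᶠ y in 𝓝 x,
      Metric.infDist y (segment ℝ a b) = dist y p ∧
      Metric.infDist y (segment ℝ c d) = dist y q := by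
  have hne := hpq.ne h
  have hl := hpq.left
  have hr := hpq.right
  -- Equality would put a third endpoint on the tangent through `p` and `q`.
  have strict : ∀ r, (r = a ∨ r = b ∨ r = c ∨ r = d) → r ≠ p → r ≠ q →
      inner ℝ (unitNormal p q) r < inner ℝ (unitNormal p q) p := by
    intro r hr hrp hrq
    refine (hpq.inner_le r hr).lt_of_ne fun he => ?_
    refine hcol p q r (by tauto) (by tauto) hr hne hrp.symm hrq.symm
      (collinear_of_inner_eq (u := unitNormal p q) (unitNormal_ne_zero hne) ?_ ?_)
    · rw [real_inner_comm, inner_unitNormal_right, real_inner_comm]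
    · rw [real_inner_comm, he, real_inner_comm]
  have hd : ∀ x y, x = a ∨ x = b → y = c ∨ y = d → x ≠ y := fun x y =>
    endpoint_ne_of_disjoint h
  have e1 := eventually_infDist_segment_eq_dist (u := unitNormal p q) hl
    fun r hr' hrp => strict r (by tauto) hrp (hd r q hr' hr)
  have e2 := eventually_infDist_segment_eq_dist (u := unitNormal p q) hr
    fun r hr' hrq => by
      rw [inner_unitNormal_right]
      exact strict r (by tauto) (hd p r hl hr').symm hrq
  filter_upwards [e1, e2] with x h1 h2 using h1.and h2

/-- Near this direction a tie between the segments is a tie between `p` and `q`, so `x` is on their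
perpendicular bisector, on the half that the normal points to. -/
lemma IsSupportingPair.eventually_mem_ray (h : Disjoint (segment ℝ a b) (segment ℝ c d))
    (hcol : NoThreeCollinear a b c d) (hpq : IsSupportingPair a b c d p q) :
    ∀ᶠ x in directionFilter (unitNormal p q),
      Metric.infDist x (segment ℝ a b) = Metric.infDist x (segment ℝ c d) →
      ∃ t : ℝ, 0 < t ∧ x = midpoint ℝ p q + t • unitNormal p q := by
  have hne := hpq.ne h
  have hneg : inner ℝ (unitNormal p q) (-unitNormal p q) < 0 := by
    rw [inner_neg_right, real_inner_self_eq_norm_sq, norm_unitNormal hne]; norm_num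
  filter_upwards [hpq.eventually_infDist_eq h hcol,
    eventually_inner_sub_neg (midpoint ℝ p q) hneg] with x hx hpos htie
  obtain ⟨h1, h2⟩ := hx.self_of_nhds
  rw [inner_neg_right, neg_neg_iff_pos] at hpos
  exact ⟨_, hpos, eq_midpoint_add_of_dist_eq hne (by rw [← h1, ← h2, htie])⟩

/-- The two `∃ᶠ` clauses say that both strict sides accumulate at every far point of the ray, which
later puts it in the closures of two regions. -/
lemma IsSupportingPair.eventually_of_mem_ray (h : Disjoint (segment ℝ a b) (segment ℝ c d))
    (hcol : NoThreeCollinear a b c d) (hpq : IsSupportingPair a b c d p q) :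
    ∀ᶠ x in cobounded Plane, (∃ t : ℝ, 0 < t ∧ x = midpoint ℝ p q + t • unitNormal p q) →
      Metric.infDist x (segment ℝ a b) = Metric.infDist x (segment ℝ c d) ∧
      (∃ᶠ y in 𝓝 x, Metric.infDist y (segment ℝ a b) < Metric.infDist y (segment ℝ c d)) ∧
      ∃ᶠ y in 𝓝 x, Metric.infDist y (segment ℝ c d) < Metric.infDist y (segment ℝ a b) := by
  have hne := hpq.ne h
  filter_upwards [eventually_ray_of_directionFilter (norm_unitNormal hne)
    (hpq.eventually_infDist_eq h hcol)] with x hx hray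
  have hx := hx hray
  obtain ⟨h1, h2⟩ := hx.self_of_nhds
  obtain ⟨t, -, hxt⟩ := hray
  have hd := dist_eq_of_eq_midpoint_add hxt
  refine ⟨by rw [h1, h2, hd], ?_, ?_⟩
  · refine ((mem_closure_dist_lt hne hd).and_eventually hx).mono ?_
    rintro y ⟨hy, e1, e2⟩
    rwa [e1, e2]
  · refine ((mem_closure_dist_lt hne.symm hd.symm).and_eventually hx).mono ?_
    rintro y ⟨hy, e1, e2⟩
    rwa [e1, e2]

lemma exists_endpoint_eq_supportFn (a b u : Plane) :
    ∃ p, (p = a ∨ p = b) ∧ inner ℝ u p = supportFn a b u := by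
  rcases le_total (inner ℝ u a) (inner ℝ u b) with h | h
  · exact ⟨b, .inr rfl, (max_eq_right h).symm⟩
  · exact ⟨a, .inl rfl, (max_eq_left h).symm⟩

lemma inner_le_supportFn {r : Plane} (u : Plane) (hr : r = a ∨ r = b) :
    inner ℝ u r ≤ supportFn a b u := by
  rcases hr with rfl | rfl
  exacts [le_max_left _ _, le_max_right _ _]

lemma isSupportingPair_of_unitNormal {u : Plane} (hne : p ≠ q) (hp : p = a ∨ p = b)
    (hq : q = c ∨ q = d) (hpu : inner ℝ u p = supportFn a b u)
    (he : supportFn a b u = supportFn c d u) (hu : u = unitNormal p q) :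
    IsSupportingPair a b c d p q := by
  refine ⟨hp, hq, fun r hr => ?_⟩
  have hle : inner ℝ u r ≤ inner ℝ u p := by
    rw [hpu]
    rw [← or_assoc] at hr
    rcases hr with hr | hr
    · exact inner_le_supportFn u hr
    · exact he ▸ inner_le_supportFn u hr
  have hpos : 0 < ‖q - p‖⁻¹ := inv_pos.2 (norm_pos_iff.2 (sub_ne_zero.2 hne.symm))
  rw [hu, unitNormal, real_inner_smul_left, real_inner_smul_left, real_inner_comm,
    real_inner_comm p] at hle
  exact le_of_mul_le_mul_left hle hpos

/-- The directions in which the support functions of two segments agree are the normals of the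
two supporting pairs. -/
lemma exists_isSupportingPair_of_supportFn_eq {u : Plane} (hu : ‖u‖ = 1)
    (h : Disjoint (segment ℝ a b) (segment ℝ c d)) (he : supportFn a b u = supportFn c d u) :
    (∃ p q, IsSupportingPair a b c d p q ∧ u = unitNormal p q) ∨
      ∃ p q, IsSupportingPair c d a b p q ∧ u = unitNormal p q := by
  obtain ⟨p, hp, hpu⟩ := exists_endpoint_eq_supportFn a b u
  obtain ⟨q, hq, hqu⟩ := exists_endpoint_eq_supportFn c d u
  have hne : p ≠ q := endpoint_ne_of_disjoint h hp hq
  have hqp : q - p ≠ 0 := sub_ne_zero.2 hne.symm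
  have h0 : inner ℝ u (q - p) = 0 := by rw [inner_sub_right, hpu, hqu, he, sub_self]
  have h1 := eq_smul_rotCW hqp h0
  obtain ⟨s, hs⟩ : ∃ s : ℝ, u = s • unitNormal p q := by
    refine ⟨inner ℝ u (rotCW (q - p)) / ‖q - p‖, h1.trans ?_⟩
    rw [unitNormal, smul_smul]
    congr 1
    field_simp
  have hs1 : |s| = 1 := by
    rw [hs, norm_smul, norm_unitNormal hne, mul_one] at hu
    exact hu
  -- A unit vector orthogonal to `q - p` is plus or minus the normal. The minus sign reverses the
  -- tangent and thereby exchanges the two segments.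
  rcases eq_or_eq_neg_of_abs_eq hs1 with rfl | rfl
  · rw [one_smul] at hs
    exact .inl ⟨p, q, isSupportingPair_of_unitNormal hne hp hq hpu he hs, hs⟩
  · rw [neg_one_smul, ← unitNormal_swap] at hs
    exact .inr ⟨q, p, isSupportingPair_of_unitNormal hne.symm hq hp hqu he.symm hs, hs⟩

end Pair

/-- Far away, the bisector of two segments consists of two rays. -/
lemma eventually_mem_ray_of_infDist_eq {a b c d p q p' q' : Plane}
    (h : Disjoint (segment ℝ a b) (segment ℝ c d)) (hcol : NoThreeCollinear a b c d)
    (hpq : IsSupportingPair a b c d p q) (hpq' : IsSupportingPair c d a b p' q') :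
    ∀ᶠ x in cobounded Plane,
      Metric.infDist x (segment ℝ a b) = Metric.infDist x (segment ℝ c d) →
      (∃ t : ℝ, 0 < t ∧ x = midpoint ℝ p q + t • unitNormal p q) ∨
        ∃ t : ℝ, 0 < t ∧ x = midpoint ℝ p' q' + t • unitNormal p' q' := by
  -- Direction by direction: different support functions exclude a tie, and equal ones force `u` to
  -- be one of the two tangent normals.
  refine eventually_cobounded_of_directionFilter fun u hu => ?_
  rcases lt_trichotomy (supportFn a b u) (supportFn c d u) with he | he | he
  · filter_upwards [eventually_infDist_lt_of_supportFn_lt hu he] with x hx hx'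
    exact absurd hx' hx.ne'
  · rcases exists_isSupportingPair_of_supportFn_eq hu h he with ⟨p₁, q₁, h₁, rfl⟩ | ⟨p₁, q₁, h₁, rfl⟩
    · obtain ⟨rfl, rfl⟩ := h₁.unique h hcol hpq
      filter_upwards [h₁.eventually_mem_ray h hcol] with x hx htie using .inl (hx htie)
    · obtain ⟨rfl, rfl⟩ := h₁.unique h.symm hcol.symm hpq'
      filter_upwards [h₁.eventually_mem_ray h.symm hcol.symm] with x hx htie
      exact .inr (hx htie.symm)
  · filter_upwards [eventually_infDist_lt_of_supportFn_lt hu he] with x hx hx'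
    exact absurd hx' hx.ne

/-- The two supporting pairs of two segments have different normals. -/
lemma IsSupportingPair.unitNormal_ne {a b c d p q p' q' : Plane}
    (h : Disjoint (segment ℝ a b) (segment ℝ c d)) (hcol : NoThreeCollinear a b c d)
    (hpq : IsSupportingPair a b c d p q) (hpq' : IsSupportingPair c d a b p' q') :
    unitNormal p q ≠ unitNormal p' q' := by
  intro hw
  have hne := hpq.ne h
  have hne' := hpq'.ne h.symm
  have hd : ∀ x y, x = a ∨ x = b → y = c ∨ y = d → x ≠ y := fun x y =>
    endpoint_ne_of_disjoint h
  have hl := hpq.left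
  have hr := hpq.right
  have hl' := hpq'.left
  have hr' := hpq'.right
  have e1 : inner ℝ (unitNormal p q) p' = inner ℝ (unitNormal p q) p := by
    rw [← hpq.supportFn_right, hw, hpq'.supportFn_left]
  have e2 : inner ℝ (unitNormal p q) q' = inner ℝ (unitNormal p q) p := by
    rw [← e1, hw, inner_unitNormal_right]
  have hu := unitNormal_ne_zero hne
  have hq : inner ℝ q (unitNormal p q) = inner ℝ p (unitNormal p q) := by
    rw [real_inner_comm, inner_unitNormal_right, real_inner_comm]
  -- Equal normals would make the two tangents the same line, so `(p', q') = (q, p)`; but the swap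
  -- negates the normal.
  have h1 : p' = q := by
    by_contra hp
    exact hcol p q p' (by tauto) (by tauto) (by tauto) hne (hd _ _ hl hl') (Ne.symm hp)
      (collinear_of_inner_eq hu hq (by rw [real_inner_comm, e1, real_inner_comm]))
  have h2 : q' = p := by
    by_contra hp
    exact hcol p q q' (by tauto) (by tauto) (by tauto) hne (Ne.symm hp) (hd _ _ hr' hr).symm
      (collinear_of_inner_eq hu hq (by rw [real_inner_comm, e2, real_inner_comm]))
  rw [h1, h2, unitNormal_swap q p] at hw
  refine unitNormal_ne_zero hne.symm (plane_ext ?_ ?_)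
  · have := congrArg (fun v : Plane => v 0) hw
    simp only [PiLp.neg_apply, PiLp.zero_apply] at this ⊢
    linarith
  · have := congrArg (fun v : Plane => v 1) hw
    simp only [PiLp.neg_apply, PiLp.zero_apply] at this ⊢
    linarith

/-- Two rays of different directions are disjoint far away. -/
lemma eventually_not_mem_both_rays {m w m' w' : Plane} (hw : ‖w‖ = 1) (hw' : ‖w'‖ = 1)
    (hne : w ≠ w') :
    ∀ᶠ x in cobounded Plane, (∃ t : ℝ, 0 < t ∧ x = m + t • w) →
      ¬ ∃ t : ℝ, 0 < t ∧ x = m' + t • w' := by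
  obtain ⟨U, V, hU, hV, hwU, hwV, hUV⟩ := t2_separation hne
  filter_upwards [eventually_ray_of_directionFilter hw (m := m)
      (tendsto_normalize w (hU.mem_nhds hwU)),
    eventually_ray_of_directionFilter hw' (m := m') (tendsto_normalize w' (hV.mem_nhds hwV))]
    with x h1 h2 h3 h4
  exact Set.disjoint_left.1 hUV (h1 h3) (h2 h4)

/-! ### All bisectors outside one large ball -/

/-- The part outside of the ball of radius `R` of the ray from `m` in direction `w`. -/
def farRay (R : ℝ) (m w : Plane) : Set Plane :=
  {x | R < ‖x‖ ∧ ∃ t : ℝ, 0 < t ∧ x = m + t • w}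

/-- The shape of the bisectors of functions `d i` outside of the ball of radius `R`: the bisector
of `d i` and `d j` consists of two disjoint rays. On the first of them, the functions that are
smaller than `d i = d j` are those with index in `K i j`. -/
structure FarStructure {n : ℕ} (d : Fin n → Plane → ℝ) (R : ℝ) (m w : Fin n → Fin n → Plane)
    (K : Fin n → Fin n → Finset (Fin n)) : Prop where
  norm_eq_one : ∀ i j, i ≠ j → ‖w i j‖ = 1
  norm_le : ∀ i j, ‖m i j‖ ≤ R
  mem_of_eq : ∀ i j, i ≠ j → ∀ x, R < ‖x‖ → d i x = d j x →
    x ∈ farRay R (m i j) (w i j) ∨ x ∈ farRay R (m j i) (w j i)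
  eq_of_mem : ∀ i j, i ≠ j → ∀ x ∈ farRay R (m i j) (w i j), d i x = d j x
  frequently_lt : ∀ i j, i ≠ j → ∀ x ∈ farRay R (m i j) (w i j), ∃ᶠ y in 𝓝 x, d i y < d j y
  frequently_gt : ∀ i j, i ≠ j → ∀ x ∈ farRay R (m i j) (w i j), ∃ᶠ y in 𝓝 x, d j y < d i y
  left_notMem : ∀ i j, i ≠ j → i ∉ K i j
  right_notMem : ∀ i j, i ≠ j → j ∉ K i j
  lt_of_mem : ∀ i j, i ≠ j → ∀ x ∈ farRay R (m i j) (w i j), ∀ l ∈ K i j, d l x < d i x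
  lt_of_notMem : ∀ i j, i ≠ j → ∀ x ∈ farRay R (m i j) (w i j), ∀ l, l ≠ i → l ≠ j → l ∉ K i j →
    d i x < d l x
  disjoint : ∀ i j, i ≠ j → Disjoint (farRay R (m i j) (w i j)) (farRay R (m j i) (w j i))

/-- Outside of a large ball. -/
lemma eventually_atTop_of_cobounded {P : Plane → Prop} (h : ∀ᶠ x in cobounded Plane, P x) :
    ∀ᶠ R : ℝ in atTop, ∀ x, R < ‖x‖ → P x := by
  obtain ⟨R, -, hR⟩ := hasBasis_cobounded_norm.eventually_iff.1 h
  filter_upwards [eventually_ge_atTop R] with S hS x hx using hR (hS.trans hx.le)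

/-- The support functions of a third segment are different on the normal of a supporting pair. -/
lemma supportFn_ne_of_isSupportingPair {n : ℕ} {a b : Fin n → Plane}
    (hdisj : DisjointSites (sites a b)) (hline : NoThreeEndpointsCollinear a b) {i j l : Fin n}
    {p q : Plane} (hij : i ≠ j) (hli : l ≠ i) (hlj : l ≠ j)
    (hpq : IsSupportingPair (a i) (b i) (a j) (b j) p q) :
    supportFn (a l) (b l) (unitNormal p q) ≠ supportFn (a i) (b i) (unitNormal p q) := by
  intro he
  have mem : ∀ {i r}, r = a i ∨ r = b i → r ∈ Set.range a ∪ Set.range b := by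
    rintro i r (rfl | rfl)
    exacts [.inl ⟨i, rfl⟩, .inr ⟨i, rfl⟩]
  have hd : ∀ {i j}, i ≠ j → ∀ {x y}, x = a i ∨ x = b i → y = a j ∨ y = b j → x ≠ y :=
    fun hij => endpoint_ne_of_disjoint (hdisj hij)
  obtain ⟨r, hr, hru⟩ := exists_endpoint_eq_supportFn (a l) (b l) (unitNormal p q)
  have hne := hd hij hpq.left hpq.right
  refine hline p (mem hpq.left) q (mem hpq.right) r (mem hr) hne
    (hd hli.symm hpq.left hr) (hd hlj.symm hpq.right hr)
    (collinear_of_inner_eq (unitNormal_ne_zero hne) ?_ ?_)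
  · rw [real_inner_comm, inner_unitNormal_right, real_inner_comm]
  · rw [real_inner_comm, hru, he, hpq.supportFn_left, real_inner_comm]

lemma exists_farStructure {n : ℕ} {a b : Fin n → Plane}
    (hdisj : DisjointSites (sites a b)) (hline : NoThreeEndpointsCollinear a b) :
    ∃ R m w K, FarStructure (fun i x => Metric.infDist x (sites a b i)) R m w K := by
  classical
  have hcol : ∀ i j, NoThreeCollinear (a i) (b i) (a j) (b j) := by
    intro i j x y z hx hy hz
    have mem : ∀ r, r = a i ∨ r = b i ∨ r = a j ∨ r = b j → r ∈ Set.range a ∪ Set.range b := by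
      rintro r (rfl | rfl | rfl | rfl)
      exacts [.inl ⟨i, rfl⟩, .inr ⟨i, rfl⟩, .inl ⟨j, rfl⟩, .inr ⟨j, rfl⟩]
    exact hline x (mem x hx) y (mem y hy) z (mem z hz)
  choose! p q hpq using fun i j (hij : i ≠ j) =>
    exists_isSupportingPair (a := a i) (b := b i) (c := a j) (d := b j) (hdisj hij)
  have hne : ∀ i j, i ≠ j → p i j ≠ q i j := fun i j hij => (hpq i j hij).ne (hdisj hij)
  have hw : ∀ i j, i ≠ j → ‖unitNormal (p i j) (q i j)‖ = 1 := fun i j hij =>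
    norm_unitNormal (hne i j hij)
  -- A larger support function means a smaller distance far away.
  set K : Fin n → Fin n → Finset (Fin n) := fun i j =>
    {l | supportFn (a i) (b i) (unitNormal (p i j) (q i j)) <
      supportFn (a l) (b l) (unitNormal (p i j) (q i j))} with hK
  have all : ∀ {P : Fin n → Fin n → Plane → Prop},
      (∀ i j, i ≠ j → ∀ᶠ x in cobounded Plane, P i j x) →
      ∀ᶠ R : ℝ in atTop, ∀ i j, i ≠ j → ∀ x, R < ‖x‖ → P i j x := by
    intro P h
    simp only [eventually_all]
    exact fun i j hij => eventually_atTop_of_cobounded (h i j hij)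
  have e1 := all fun i j hij => eventually_mem_ray_of_infDist_eq (hdisj hij) (hcol i j)
    (hpq i j hij) (hpq j i hij.symm)
  have e2 := all fun i j hij => (hpq i j hij).eventually_of_mem_ray (hdisj hij) (hcol i j)
  have e3 := all fun i j hij => eventually_not_mem_both_rays (m := midpoint ℝ (p i j) (q i j))
    (m' := midpoint ℝ (p j i) (q j i)) (hw i j hij)
    (hw j i hij.symm) ((hpq i j hij).unitNormal_ne (hdisj hij) (hcol i j) (hpq j i hij.symm))
  have e4 : ∀ᶠ R : ℝ in atTop, ∀ i j, ‖midpoint ℝ (p i j) (q i j)‖ ≤ R := by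
    simp only [eventually_all]
    exact fun i j => eventually_ge_atTop _
  -- No third segment ties with `i` at the normal, so its rank relative to `i` is eventually
  -- constant along the ray.
  have e5 := all (P := fun i j x =>
      (∃ t : ℝ, 0 < t ∧ x = midpoint ℝ (p i j) (q i j) + t • unitNormal (p i j) (q i j)) →
      ∀ l, l ≠ i → l ≠ j →
      (l ∈ K i j → Metric.infDist x (sites a b l) < Metric.infDist x (sites a b i)) ∧
      (l ∉ K i j → Metric.infDist x (sites a b i) < Metric.infDist x (sites a b l))) (by
    intro i j hij
    refine eventually_ray_of_directionFilter (hw i j hij) ?_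
    simp only [eventually_all]
    intro l hli hlj
    rcases (supportFn_ne_of_isSupportingPair hdisj hline hij hli hlj (hpq i j hij)).lt_or_gt
      with h | h
    · filter_upwards [eventually_infDist_lt_of_supportFn_lt (hw i j hij) h] with x hx
      refine ⟨fun hl => ?_, fun _ => hx⟩
      exact absurd (Finset.mem_filter.1 hl).2 h.not_gt
    · filter_upwards [eventually_infDist_lt_of_supportFn_lt (hw i j hij) h] with x hx
      refine ⟨fun _ => hx, fun hl => ?_⟩
      exact absurd (Finset.mem_filter.2 ⟨Finset.mem_univ l, h⟩ : l ∈ K i j) hl)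
  obtain ⟨R, h1, h2, h3, h4, h5⟩ := (e1.and (e2.and (e3.and (e4.and e5)))).exists
  have left : ∀ i j, i ≠ j → i ∉ K i j := fun i j _ hi =>
    lt_irrefl _ (Finset.mem_filter.1 hi).2
  have right : ∀ i j, i ≠ j → j ∉ K i j := fun i j hij hj => by
    have := (Finset.mem_filter.1 hj).2
    rw [(hpq i j hij).supportFn_left, (hpq i j hij).supportFn_right] at this
    exact lt_irrefl _ this
  refine ⟨R, fun i j => midpoint ℝ (p i j) (q i j), fun i j => unitNormal (p i j) (q i j), K,
    hw, h4, ?_, ?_, ?_, ?_, left, right, ?_, ?_, ?_⟩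
  · intro i j hij x hx he
    exact (h1 i j hij x hx he).imp (fun h => ⟨hx, h⟩) fun h => ⟨hx, h⟩
  · exact fun i j hij x hx => (h2 i j hij x hx.1 hx.2).1
  · exact fun i j hij x hx => (h2 i j hij x hx.1 hx.2).2.1
  · exact fun i j hij x hx => (h2 i j hij x hx.1 hx.2).2.2
  · intro i j hij x hx l hl
    refine (h5 i j hij x hx.1 hx.2 l ?_ ?_).1 hl
    · rintro rfl; exact left _ _ hij hl
    · rintro rfl; exact right _ _ hij hl
  · exact fun i j hij x hx l hli hlj hl => (h5 i j hij x hx.1 hx.2 l hli hlj).2 hl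
  · exact fun i j hij => Set.disjoint_left.2 fun x hx hx' => h3 i j hij x hx.1 hx.2 hx'.2

/-! ### Rays -/

section Ray

variable {R : ℝ} {m w : Plane}

lemma isometry_ray (hw : ‖w‖ = 1) : Isometry fun t : ℝ => m + t • w := by
  refine Isometry.of_dist_eq fun s t => ?_
  rw [dist_eq_norm, dist_eq_norm, add_sub_add_left_eq_sub, ← sub_smul, norm_smul, hw, mul_one]

/-- A ray starting in the ball cannot re-enter it: `‖m + r • w‖² = ‖m‖² + r (2⟪m, w⟫ + r)`, and the
bracket, once positive, stays positive and grows with `r`. -/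
lemma lt_norm_of_le (hw : ‖w‖ = 1) (hm : ‖m‖ ≤ R) {s t : ℝ} (hs : 0 < s)
    (h : R < ‖m + s • w‖) (hst : s ≤ t) : R < ‖m + t • w‖ := by
  have hR : 0 ≤ R := (norm_nonneg _).trans hm
  have key : ∀ r : ℝ, ‖m + r • w‖ ^ 2 = ‖m‖ ^ 2 + r * (2 * inner ℝ m w + r) := fun r => by
    rw [norm_add_sq_real, inner_smul_right, norm_smul, hw, mul_one, Real.norm_eq_abs, sq_abs]
    ring
  have h1 : R ^ 2 < ‖m + s • w‖ ^ 2 := by gcongr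
  have h2 : ‖m‖ ^ 2 ≤ R ^ 2 := by gcongr
  refine lt_of_pow_lt_pow_left₀ 2 (norm_nonneg _) ?_
  rw [key] at h1 ⊢
  have h3 : 0 < 2 * inner ℝ m w + s := pos_of_mul_pos_right (by linarith) hs.le
  have ht : 0 ≤ t := hs.le.trans hst
  have h4 : s * (2 * inner ℝ m w + s) ≤ t * (2 * inner ℝ m w + t) := by gcongr
  linarith

lemma isPreconnected_farRay (hw : ‖w‖ = 1) (hm : ‖m‖ ≤ R) : IsPreconnected (farRay R m w) := by
  have himg : farRay R m w = (fun t : ℝ => m + t • w) '' {t | 0 < t ∧ R < ‖m + t • w‖} := by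
    ext x
    constructor
    · rintro ⟨hx, t, ht, rfl⟩
      exact ⟨t, ⟨ht, hx⟩, rfl⟩
    · rintro ⟨t, ⟨ht, hx⟩, rfl⟩
      exact ⟨hx, t, ht, rfl⟩
  rw [himg]
  refine IsPreconnected.image ?_ _ (isometry_ray hw).continuous.continuousOn
  refine Set.OrdConnected.isPreconnected ⟨fun s hs t _ r hr => ?_⟩
  exact ⟨hs.1.trans_le hr.1, lt_norm_of_le hw hm hs.1 hs.2 hr.1⟩

/-- A point of the ray from `m` in direction `w` outside of the ball of radius `R`. -/
noncomputable def farPoint (R : ℝ) (m w : Plane) : Plane := m + (R + ‖m‖ + 1) • w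

lemma norm_lt_norm_add_smul (hw : ‖w‖ = 1) {t : ℝ} (ht : R + ‖m‖ < t) : R < ‖m + t • w‖ := by
  have h1 : ‖t • w‖ ≤ ‖m + t • w‖ + ‖m‖ := by
    have := norm_sub_le (m + t • w) m
    rwa [add_sub_cancel_left] at this
  rw [norm_smul, hw, mul_one, Real.norm_eq_abs] at h1
  linarith [le_abs_self t]

lemma farPoint_mem (hw : ‖w‖ = 1) (hm : ‖m‖ ≤ R) : farPoint R m w ∈ farRay R m w :=
  ⟨norm_lt_norm_add_smul hw (by linarith), _,
    by linarith [norm_nonneg m], rfl⟩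

lemma farRay_anti {S : ℝ} (h : R ≤ S) : farRay S m w ⊆ farRay R m w :=
  fun _ hx => ⟨h.trans_lt hx.1, hx.2⟩

lemma exists_lt_norm_of_not_isBounded {s : Set Plane} (h : ¬ IsBounded s) (M : ℝ) :
    ∃ x ∈ s, M < ‖x‖ := by
  by_contra! hc
  exact h (isBounded_iff_forall_norm_le.2 ⟨M, hc⟩)

lemma not_isBounded_farRay (hw : ‖w‖ = 1) (hm : ‖m‖ ≤ R) : ¬ IsBounded (farRay R m w) := by
  intro h
  obtain ⟨M, hM⟩ := isBounded_iff_forall_norm_le.1 h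
  have h1 := farPoint_mem hw (hm.trans (le_max_left R M))
  exact ((le_max_right R M).trans_lt h1.1).not_ge (hM _ (farRay_anti (le_max_left R M) h1))

/-- A set with a single far end is not unbounded in both directions. -/
lemma not_unboundedInBothDirections {e : Set Plane} (hw : ‖w‖ = 1) (hm : ‖m‖ ≤ R)
    (hsub : farRay R m w ⊆ e) (hfar : ∀ x ∈ e, R < ‖x‖ → x ∈ farRay R m w) :
    ¬ UnboundedInBothDirections e := by
  rintro ⟨x, hx, y, hy, z, hz, hne, hby, hbz⟩
  -- The radius `max R ‖x‖` leaves out the deleted point. This connected tail meets both unbounded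
  -- components, so they coincide.
  have hpre : IsPreconnected (farRay (max R ‖x‖) m w) :=
    isPreconnected_farRay hw (hm.trans (le_max_left _ _))
  have hsub' : farRay (max R ‖x‖) m w ⊆ e \ {x} := fun v hv => by
    refine ⟨hsub (farRay_anti (le_max_left _ _) hv), ?_⟩
    rintro rfl
    exact ((le_max_right R ‖v‖).trans_lt hv.1).false
  have key : ∀ v, ¬ IsBounded (connectedComponentIn (e \ {x}) v) →
      ∃ v' ∈ farRay (max R ‖x‖) m w, v' ∈ connectedComponentIn (e \ {x}) v := fun v hv => by
    obtain ⟨v', hv', hlt⟩ := exists_lt_norm_of_not_isBounded hv (max R ‖x‖)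
    exact ⟨v', ⟨hlt, (hfar v' (connectedComponentIn_subset _ _ hv').1
      ((le_max_left _ _).trans_lt hlt)).2⟩, hv'⟩
  obtain ⟨y', hy', hyc⟩ := key y hby
  obtain ⟨z', hz', hzc⟩ := key z hbz
  refine hne ?_
  rw [connectedComponentIn_eq hyc, connectedComponentIn_eq hzc]
  exact connectedComponentIn_eq (hpre.subset_connectedComponentIn hy' hsub' hz')

/-- A set with two far ends is unbounded in both directions. -/
lemma unboundedInBothDirections_of_farRays {e : Set Plane} {m' w' : Plane} (hw : ‖w‖ = 1)
    (hm : ‖m‖ ≤ R) (hw' : ‖w'‖ = 1) (hm' : ‖m'‖ ≤ R) (hsub : farRay R m w ⊆ e)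
    (hsub' : farRay R m' w' ⊆ e) (hdisj : Disjoint (farRay R m w) (farRay R m' w'))
    (hfar : ∀ x ∈ e, R < ‖x‖ → x ∈ farRay R m w ∨ x ∈ farRay R m' w') :
    UnboundedInBothDirections e := by
  set T := R + ‖m‖ + 1 with hT
  have hR : 0 ≤ R := (norm_nonneg _).trans hm
  have hT0 : 0 < T := by linarith [norm_nonneg m]
  have hiso := isometry_ray (m := m) hw
  have hray : ∀ t, T ≤ t → m + t • w ∈ farRay R m w := fun t ht =>
    ⟨norm_lt_norm_add_smul hw (by linarith), t, hT0.trans_le ht, rfl⟩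
  have hO : (fun t : ℝ => m + t • w) '' Set.Ioi T ⊆ e \ {m + T • w} := by
    rintro _ ⟨t, ht, rfl⟩
    refine ⟨hsub (hray t (le_of_lt ht)), fun h => ?_⟩
    exact (ne_of_gt ht) (hiso.injective h)
  have hOpre : IsPreconnected ((fun t : ℝ => m + t • w) '' Set.Ioi T) :=
    isPreconnected_Ioi.image _ hiso.continuous.continuousOn
  have hyO : m + (T + 1) • w ∈ (fun t : ℝ => m + t • w) '' Set.Ioi T :=
    ⟨T + 1, by simp, rfl⟩
  have hz := farPoint_mem hw' hm'
  have hr2 : farRay R m' w' ⊆ e \ {m + T • w} := fun v hv => by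
    refine ⟨hsub' hv, ?_⟩
    rintro rfl
    exact Set.disjoint_left.1 hdisj (hray T le_rfl) hv
  refine ⟨m + T • w, hsub (hray T le_rfl), _, hO hyO, _, hr2 hz, fun heq => ?_, fun hb => ?_,
    fun hb => ?_⟩
  -- Cut the first ray at parameter `T`. Two closed sets cover `e`: the tail from `T` on, and the
  -- ball with the initial piece and the other ray. Within `e` they meet only at the deleted point,
  -- so no component meets both.
  · have hpre := isPreconnected_connectedComponentIn (F := e \ {m + T • w})
      (x := m + (T + 1) • w)
    have hemb := hiso.isClosedEmbedding
    have hemb' := (isometry_ray (m := m') hw').isClosedEmbedding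
    obtain ⟨v, hv, ⟨t, ht, htv⟩, hv2⟩ := isPreconnected_closed_iff.1 hpre
      ((fun t : ℝ => m + t • w) '' Set.Ici T)
      ((Metric.closedBall 0 R ∪ (fun t : ℝ => m + t • w) '' Set.Icc 0 T) ∪
        (fun t : ℝ => m' + t • w') '' Set.Ici 0)
      (hemb.isClosedMap _ isClosed_Ici)
      ((Metric.isClosed_closedBall.union (hemb.isClosedMap _ isClosed_Icc)).union
        (hemb'.isClosedMap _ isClosed_Ici))
      (by
        intro v hv
        by_cases hvR : R < ‖v‖
        · rcases hfar v (connectedComponentIn_subset _ _ hv).1 hvR with h | h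
          · obtain ⟨-, t, ht, rfl⟩ := h
            rcases le_total T t with h | h
            · exact .inl ⟨t, h, rfl⟩
            · exact .inr (.inl (.inr ⟨t, ⟨ht.le, h⟩, rfl⟩))
          · obtain ⟨-, t, ht, rfl⟩ := h
            exact .inr (.inr ⟨t, ht.le, rfl⟩)
        · exact .inr (.inl (.inl (by simpa using hvR))))
      ⟨_, mem_connectedComponentIn (hO hyO), T + 1, by simp, rfl⟩
      ⟨_, heq ▸ mem_connectedComponentIn (hr2 hz), by
        obtain ⟨-, t, ht, hzt⟩ := hz
        exact .inr ⟨t, ht.le, hzt.symm⟩⟩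
    have hvr : v ∈ farRay R m w := htv ▸ hray t ht
    rcases hv2 with (hv2 | ⟨s, hs, hsv⟩) | ⟨s, hs, hsv⟩
    · rw [mem_closedBall_zero_iff] at hv2
      exact hvr.1.not_ge hv2
    · have hst : s = t := hiso.injective (hsv.trans htv.symm)
      have hsT : s = T := le_antisymm hs.2 (hst ▸ ht)
      refine (connectedComponentIn_subset _ _ hv).2 ?_
      rw [← hsv, hsT]
      rfl
    · refine Set.disjoint_left.1 hdisj hvr ⟨hvr.1, s, lt_of_le_of_ne hs ?_, hsv.symm⟩
      rintro rfl
      have : v = m' := by simpa using hsv.symm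
      exact hvr.1.not_ge (this ▸ hm')
  · have hS := hb.subset (hOpre.subset_connectedComponentIn hyO hO)
    obtain ⟨M, hM⟩ := isBounded_iff_forall_norm_le.1 hS
    have h1 : max T (M + ‖m‖) + 1 ∈ Set.Ioi T := by
      have := le_max_left T (M + ‖m‖)
      simp only [Set.mem_Ioi]; linarith
    have h2 := hM _ ⟨_, h1, rfl⟩
    have h3 : M < ‖m + (max T (M + ‖m‖) + 1) • w‖ :=
      norm_lt_norm_add_smul hw (by linarith [le_max_right T (M + ‖m‖)])
    exact h3.not_ge h2
  · exact not_isBounded_farRay hw' hm' (hb.subset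
      ((isPreconnected_farRay hw' hm').subset_connectedComponentIn hz hr2))

end Ray

/-! ### Regions far away -/

section Region

variable {n : ℕ} {s : Fin n → Set Plane}

lemma infDist_le_of_mem_closure_region {A : Finset (Fin n)} {x : Plane}
    (hx : x ∈ closure (region s A)) {i j : Fin n} (hi : i ∈ A) (hj : j ∉ A) :
    Metric.infDist x (s i) ≤ Metric.infDist x (s j) :=
  closure_minimal (t := {x | Metric.infDist x (s i) ≤ Metric.infDist x (s j)})
    (fun _ hy => (hy i hi j hj).le)
    (isClosed_le (Metric.continuous_infDist_pt _) (Metric.continuous_infDist_pt _)) hx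

/-- Strict inequalities at `x` persist nearby, and the tie of `i` with `j` is the only one that
matters. Nearby points where `i` beats `j` lie in the region. -/
lemma mem_closure_region_insert [DecidableEq (Fin n)] {x : Plane} {i j : Fin n}
    {K : Finset (Fin n)}
    (hlt : ∀ l ∈ K, Metric.infDist x (s l) < Metric.infDist x (s i))
    (hgt : ∀ l, l ≠ i → l ≠ j → l ∉ K → Metric.infDist x (s i) < Metric.infDist x (s l))
    (htie : Metric.infDist x (s i) = Metric.infDist x (s j))
    (hfreq : ∃ᶠ y in 𝓝 x, Metric.infDist y (s i) < Metric.infDist y (s j)) :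
    x ∈ closure (region s (insert i K)) := by
  have hev : ∀ᶠ y in 𝓝 x, ∀ l l', Metric.infDist x (s l) < Metric.infDist x (s l') →
      Metric.infDist y (s l) < Metric.infDist y (s l') := by
    simp only [eventually_all]
    intro l l' h
    exact ((Metric.continuous_infDist_pt (s l)).tendsto x).eventually_lt
      ((Metric.continuous_infDist_pt (s l')).tendsto x) h
  rw [mem_closure_iff_frequently]
  refine (hfreq.and_eventually hev).mono ?_
  rintro y ⟨hy, hev⟩ l hl l' hl'
  rw [Finset.mem_insert, not_or] at hl'
  rcases Finset.mem_insert.1 hl with rfl | hl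
  · by_cases hlj : l' = j
    · rwa [hlj]
    · exact hev _ _ (hgt l' hl'.1 hlj hl'.2)
  · apply hev
    by_cases hlj : l' = j
    · rw [hlj, ← htie]
      exact hlt l hl
    · exact (hlt l hl).trans (hgt l' hl'.1 hlj hl'.2)

lemma commonBoundary_comm (s : Fin n → Set Plane) (k : ℕ) (A B : Finset (Fin n)) :
    commonBoundary s k A B = commonBoundary s k B A := by
  rw [commonBoundary, commonBoundary, Set.inter_comm]

end Region

/-! ### Edges with far points and the rays they contain -/

section Edge

variable {n : ℕ} {s : Fin n → Set Plane} {R : ℝ} {m w : Fin n → Fin n → Plane}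
  {K : Fin n → Fin n → Finset (Fin n)}

lemma FarStructure.mem_closure_left
    (hF : FarStructure (fun i x => Metric.infDist x (s i)) R m w K) {i j : Fin n} (hij : i ≠ j)
    {x : Plane} (hx : x ∈ farRay R (m i j) (w i j)) :
    x ∈ closure (region s (insert i (K i j))) :=
  mem_closure_region_insert (hF.lt_of_mem i j hij x hx) (hF.lt_of_notMem i j hij x hx)
    (hF.eq_of_mem i j hij x hx) (hF.frequently_lt i j hij x hx)

lemma FarStructure.mem_closure_right
    (hF : FarStructure (fun i x => Metric.infDist x (s i)) R m w K) {i j : Fin n} (hij : i ≠ j)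
    {x : Plane} (hx : x ∈ farRay R (m i j) (w i j)) :
    x ∈ closure (region s (insert j (K i j))) := by
  have he := hF.eq_of_mem i j hij x hx
  refine mem_closure_region_insert (j := i) ?_ ?_ he.symm (hF.frequently_gt i j hij x hx)
  · exact fun l hl => he ▸ hF.lt_of_mem i j hij x hx l hl
  · exact fun l hlj hli hl => he ▸ hF.lt_of_notMem i j hij x hx l hli hlj hl

/-- A region of `A` with `i ∈ A`, `j ∉ A` that reaches a far point of the bisector of `i`, `j`. -/
lemma FarStructure.eq_insert_left
    (hF : FarStructure (fun i x => Metric.infDist x (s i)) R m w K) {i j : Fin n} (hij : i ≠ j)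
    {x : Plane} (hx : x ∈ farRay R (m i j) (w i j)) {A : Finset (Fin n)}
    (hA : x ∈ closure (region s A)) (hi : i ∈ A) (hj : j ∉ A) : A = insert i (K i j) := by
  have he := hF.eq_of_mem i j hij x hx
  ext l
  rw [Finset.mem_insert]
  constructor
  · intro hl
    by_contra! hc
    have h1 := hF.lt_of_notMem i j hij x hx l hc.1 (by rintro rfl; exact hj hl) hc.2
    have h2 := infDist_le_of_mem_closure_region hA hl hj
    exact (h2.trans_eq he.symm).not_gt h1
  · rintro (rfl | hl)
    · exact hi
    · by_contra hlA
      exact (infDist_le_of_mem_closure_region hA hi hlA).not_gt (hF.lt_of_mem i j hij x hx l hl)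

lemma FarStructure.eq_insert_right
    (hF : FarStructure (fun i x => Metric.infDist x (s i)) R m w K) {i j : Fin n} (hij : i ≠ j)
    {x : Plane} (hx : x ∈ farRay R (m i j) (w i j)) {A : Finset (Fin n)}
    (hA : x ∈ closure (region s A)) (hi : i ∉ A) (hj : j ∈ A) : A = insert j (K i j) := by
  have he := hF.eq_of_mem i j hij x hx
  ext l
  rw [Finset.mem_insert]
  constructor
  · intro hl
    by_contra! hc
    have h1 := hF.lt_of_notMem i j hij x hx l (by rintro rfl; exact hi hl) hc.1 hc.2
    have h2 := infDist_le_of_mem_closure_region hA hl hi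
    exact h2.not_gt h1
  · rintro (rfl | hl)
    · exact hj
    · by_contra hlA
      exact (he.trans_le (infDist_le_of_mem_closure_region hA hj hlA)).not_gt
        (hF.lt_of_mem i j hij x hx l hl)

/-- At `x` the ranking is `K i j`, then `i` and `j` tied, then the rest. A set of nearest sites with
both `i` and `j` has at least `|K i j| + 2` elements, one with neither at most `|K i j|`. -/
lemma FarStructure.eq_insert_of_card
    (hF : FarStructure (fun i x => Metric.infDist x (s i)) R m w K) {i j : Fin n} (hij : i ≠ j)
    {x : Plane} (hx : x ∈ farRay R (m i j) (w i j)) {A : Finset (Fin n)}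
    (hA : x ∈ closure (region s A)) (hcard : A.card = (K i j).card + 1) :
    A = insert i (K i j) ∨ A = insert j (K i j) := by
  by_cases hi : i ∈ A <;> by_cases hj : j ∈ A
  · have hsub : insert i (insert j (K i j)) ⊆ A := by
      simp only [Finset.insert_subset_iff, hi, hj, true_and]
      intro l hl
      by_contra hlA
      exact (infDist_le_of_mem_closure_region hA hi hlA).not_gt (hF.lt_of_mem i j hij x hx l hl)
    have := Finset.card_le_card hsub
    rw [Finset.card_insert_of_notMem, Finset.card_insert_of_notMem (hF.right_notMem i j hij)] at this
    · omega
    · simp [hij, hF.left_notMem i j hij]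
  · exact .inl (hF.eq_insert_left hij hx hA hi hj)
  · exact .inr (hF.eq_insert_right hij hx hA hi hj)
  · have hsub : A ⊆ K i j := by
      intro l hl
      by_contra hlK
      exact (infDist_le_of_mem_closure_region hA hl hi).not_gt
        (hF.lt_of_notMem i j hij x hx l (by rintro rfl; exact hi hl) (by rintro rfl; exact hj hl)
          hlK)
    have := Finset.card_le_card hsub
    omega

lemma FarStructure.card_insert_left {d : Fin n → Plane → ℝ} (hF : FarStructure d R m w K)
    {i j : Fin n} (hij : i ≠ j) : (insert i (K i j)).card = (K i j).card + 1 :=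
  Finset.card_insert_of_notMem (hF.left_notMem i j hij)

lemma FarStructure.card_insert_right {d : Fin n → Plane → ℝ} (hF : FarStructure d R m w K)
    {i j : Fin n} (hij : i ≠ j) : (insert j (K i j)).card = (K i j).card + 1 :=
  Finset.card_insert_of_notMem (hF.right_notMem i j hij)

lemma FarStructure.insert_ne {d : Fin n → Plane → ℝ} (hF : FarStructure d R m w K)
    {i j : Fin n} (hij : i ≠ j) : insert i (K i j) ≠ insert j (K i j) := by
  intro h
  have : i ∈ insert j (K i j) := h ▸ Finset.mem_insert_self i _
  rcases Finset.mem_insert.1 this with h | h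
  exacts [hij h, hF.left_notMem i j hij h]

/-- Only two sets of this order have `x` in the closure of their region, so by pigeonhole `x` is not
a vertex. -/
lemma FarStructure.farRay_subset_commonBoundary
    (hF : FarStructure (fun i x => Metric.infDist x (s i)) R m w K) {i j : Fin n} (hij : i ≠ j) :
    farRay R (m i j) (w i j) ⊆
      commonBoundary s ((K i j).card + 1) (insert i (K i j)) (insert j (K i j)) := by
  intro x hx
  refine ⟨⟨hF.mem_closure_left hij hx, hF.mem_closure_right hij hx⟩, ?_⟩
  rintro ⟨A, B, C, hA, hB, hC, hAB, hAC, hBC, hxA, hxB, hxC⟩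
  rcases hF.eq_insert_of_card hij hx hxA hA with rfl | rfl <;>
  rcases hF.eq_insert_of_card hij hx hxB hB with rfl | rfl <;>
  rcases hF.eq_insert_of_card hij hx hxC hC with rfl | rfl <;>
  contradiction

/-- The edge that contains the far ray of the ordered pair `(i, j)`. -/
noncomputable def farEdge (s : Fin n → Set Plane) (R : ℝ) (m w : Fin n → Fin n → Plane)
    (K : Fin n → Fin n → Finset (Fin n)) (i j : Fin n) : Set Plane :=
  connectedComponentIn
    (commonBoundary s ((K i j).card + 1) (insert i (K i j)) (insert j (K i j)))
    (farPoint R (m i j) (w i j))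

lemma FarStructure.farRay_subset_farEdge
    (hF : FarStructure (fun i x => Metric.infDist x (s i)) R m w K) {i j : Fin n} (hij : i ≠ j) :
    farRay R (m i j) (w i j) ⊆ farEdge s R m w K i j :=
  (isPreconnected_farRay (hF.norm_eq_one i j hij) (hF.norm_le i j)).subset_connectedComponentIn
    (farPoint_mem (hF.norm_eq_one i j hij) (hF.norm_le i j)) (hF.farRay_subset_commonBoundary hij)

lemma FarStructure.farEdge_mem_edges
    (hF : FarStructure (fun i x => Metric.infDist x (s i)) R m w K) {i j : Fin n} (hij : i ≠ j) :
    farEdge s R m w K i j ∈ edges s ((K i j).card + 1) :=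
  ⟨_, _, hF.card_insert_left hij, hF.card_insert_right hij, hF.insert_ne hij, _,
    hF.farRay_subset_commonBoundary hij (farPoint_mem (hF.norm_eq_one i j hij) (hF.norm_le i j)),
    rfl⟩

lemma FarStructure.not_isBounded_farEdge
    (hF : FarStructure (fun i x => Metric.infDist x (s i)) R m w K) {i j : Fin n} (hij : i ≠ j) :
    ¬ IsBounded (farEdge s R m w K i j) := fun h =>
  not_isBounded_farRay (hF.norm_eq_one i j hij) (hF.norm_le i j)
    (h.subset (hF.farRay_subset_farEdge hij))

lemma FarStructure.connectedComponentIn_eq_farEdge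
    (hF : FarStructure (fun i x => Metric.infDist x (s i)) R m w K) {i j : Fin n} (hij : i ≠ j)
    {x : Plane} (hx : x ∈ farRay R (m i j) (w i j)) :
    connectedComponentIn
      (commonBoundary s ((K i j).card + 1) (insert i (K i j)) (insert j (K i j))) x =
      farEdge s R m w K i j :=
  (connectedComponentIn_eq (hF.farRay_subset_farEdge hij hx)).symm

/-- An edge that has a far point contains the far ray through this point. -/
lemma FarStructure.exists_eq_farEdge
    (hF : FarStructure (fun i x => Metric.infDist x (s i)) R m w K) {k : ℕ} {e : Set Plane}
    (he : e ∈ edges s k) {x : Plane} (hx : x ∈ e) (hR : R < ‖x‖) :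
    ∃ i j, i ≠ j ∧ (K i j).card + 1 = k ∧ e = farEdge s R m w K i j ∧
      x ∈ farRay R (m i j) (w i j) := by
  obtain ⟨A, B, hA, hB, hAB, y, hy, rfl⟩ := he
  have hxC := connectedComponentIn_subset _ _ hx
  rw [connectedComponentIn_eq hx]
  -- Different sets of equal size each have an element outside the other. In both closures at once,
  -- these two sites tie at `x`.
  obtain ⟨i, hi⟩ : (A \ B).Nonempty := by
    rw [Finset.sdiff_nonempty]
    exact fun h => hAB (Finset.eq_of_subset_of_card_le h (by omega))
  obtain ⟨j, hj⟩ : (B \ A).Nonempty := by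
    rw [Finset.sdiff_nonempty]
    exact fun h => hAB (Finset.eq_of_subset_of_card_le h (by omega)).symm
  rw [Finset.mem_sdiff] at hi hj
  have hij : i ≠ j := by rintro rfl; exact hi.2 hj.1
  have htie : Metric.infDist x (s i) = Metric.infDist x (s j) :=
    le_antisymm (infDist_le_of_mem_closure_region hxC.1.1 hi.1 hj.2)
      (infDist_le_of_mem_closure_region hxC.1.2 hj.1 hi.2)
  rcases hF.mem_of_eq i j hij x hR htie with h | h
  · have h1 := hF.eq_insert_left hij h hxC.1.1 hi.1 hj.2
    have h2 := hF.eq_insert_right hij h hxC.1.2 hi.2 hj.1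
    have h3 : (K i j).card + 1 = k := by rw [← hF.card_insert_left hij, ← h1, hA]
    refine ⟨i, j, hij, h3, ?_, h⟩
    rw [← hF.connectedComponentIn_eq_farEdge hij h, h3, ← h1, ← h2]
  · have h1 := hF.eq_insert_left hij.symm h hxC.1.2 hj.1 hi.2
    have h2 := hF.eq_insert_right hij.symm h hxC.1.1 hj.2 hi.1
    have h3 : (K j i).card + 1 = k := by rw [← hF.card_insert_left hij.symm, ← h1, hB]
    refine ⟨j, i, hij.symm, h3, ?_, h⟩
    rw [← hF.connectedComponentIn_eq_farEdge hij.symm h, h3, ← h1, ← h2, commonBoundary_comm]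

/-- An edge contains the far rays of a single pair only. -/
lemma FarStructure.farEdge_inj
    (hF : FarStructure (fun i x => Metric.infDist x (s i)) R m w K) {i j i' j' : Fin n}
    (hij : i ≠ j) (hij' : i' ≠ j') (hcard : (K i j).card = (K i' j').card)
    (he : farEdge s R m w K i j = farEdge s R m w K i' j') :
    (i' = i ∧ j' = j) ∨ (i' = j ∧ j' = i) := by
  have hpt := farPoint_mem (hF.norm_eq_one i' j' hij') (hF.norm_le i' j')
  have hmem := connectedComponentIn_subset _ _ (he ▸ hF.farRay_subset_farEdge hij' hpt :
    farPoint R (m i' j') (w i' j') ∈ farEdge s R m w K i j)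
  -- The two neighbouring regions determine `i` as the only element of the first set missing from
  -- the second.
  have key : ∀ {i j i' j' : Fin n} {K K' : Finset (Fin n)}, i ≠ j → i ∉ K →
      insert i K = insert i' K' → insert j K = insert j' K' → i' = i := by
    intro i j i' j' K K' hij hi h1 h2
    have h3 : i ∈ insert i' K' := h1 ▸ Finset.mem_insert_self i K
    have h4 : i ∉ insert j' K' := by
      rw [← h2, Finset.mem_insert, not_or]
      exact ⟨hij, hi⟩
    rcases Finset.mem_insert.1 h3 with h | h
    · exact h.symm
    · exact absurd (Finset.mem_insert_of_mem h) h4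
  have hne := hF.insert_ne hij
  have hi := hF.left_notMem i j hij
  have hj := hF.right_notMem i j hij
  rcases hF.eq_insert_of_card hij' hpt hmem.1.1 (by rw [hF.card_insert_left hij, hcard])
    with h1 | h1 <;>
  rcases hF.eq_insert_of_card hij' hpt hmem.1.2 (by rw [hF.card_insert_right hij, hcard])
    with h2 | h2
  · exact absurd (h1.trans h2.symm) hne
  · exact .inl ⟨key hij hi h1 h2, key hij.symm hj h2 h1⟩
  · exact .inr ⟨key hij.symm hj h2 h1, key hij hi h1 h2⟩
  · exact absurd (h1.trans h2.symm) hne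

/-- An edge is unbounded in both directions if it contains both far rays of a pair. -/
lemma FarStructure.unboundedInBothDirections_farEdge_iff
    (hF : FarStructure (fun i x => Metric.infDist x (s i)) R m w K) {i j : Fin n} (hij : i ≠ j) :
    UnboundedInBothDirections (farEdge s R m w K i j) ↔
      (K j i).card = (K i j).card ∧ farEdge s R m w K j i = farEdge s R m w K i j := by
  have hfar : ∀ x ∈ farEdge s R m w K i j, R < ‖x‖ → x ∈ farRay R (m i j) (w i j) ∨
      ((K j i).card = (K i j).card ∧ farEdge s R m w K j i = farEdge s R m w K i j) ∧
        x ∈ farRay R (m j i) (w j i) := by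
    intro x hx hR
    obtain ⟨i', j', hij', hk, he, hmem⟩ :=
      hF.exists_eq_farEdge (hF.farEdge_mem_edges hij) hx hR
    rcases hF.farEdge_inj hij hij' (by omega) he with ⟨rfl, rfl⟩ | ⟨rfl, rfl⟩
    · exact .inl hmem
    · exact .inr ⟨⟨by omega, he.symm⟩, hmem⟩
  constructor
  · intro h
    by_contra hc
    exact not_unboundedInBothDirections (hF.norm_eq_one i j hij) (hF.norm_le i j)
      (hF.farRay_subset_farEdge hij)
      (fun x hx hR => (hfar x hx hR).resolve_right fun h => hc h.1) h
  · rintro ⟨-, h⟩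
    exact unboundedInBothDirections_of_farRays (hF.norm_eq_one i j hij) (hF.norm_le i j)
      (hF.norm_eq_one j i hij.symm) (hF.norm_le j i) (hF.farRay_subset_farEdge hij)
      (h ▸ hF.farRay_subset_farEdge hij.symm) (hF.disjoint i j hij)
      fun x hx hR => (hfar x hx hR).imp_right And.right

end Edge

/-! ### Counting far rays by the edges that contain them -/

/-- Counting a set by the images of its elements under a map whose fibres are contained in the
orbits of a fixed-point free involution `σ`. -/
lemma card_image_add_card_image_filter {α β : Type*} [DecidableEq α] [DecidableEq β]
    (D : Finset α) (f : α → β) (σ : α → α) (hσ : ∀ x ∈ D, σ x ≠ x)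
    (hf : ∀ x ∈ D, ∀ y ∈ D, f x = f y → y = x ∨ y = σ x) :
    (D.image f).card + ((D.filter fun x => σ x ∈ D ∧ f (σ x) = f x).image f).card = D.card := by
  rw [Finset.card_eq_sum_card_image f D]
  have hsub : (D.filter fun x => σ x ∈ D ∧ f (σ x) = f x).image f ⊆ D.image f :=
    Finset.image_subset_image (Finset.filter_subset _ _)
  have h1 : ((D.filter fun x => σ x ∈ D ∧ f (σ x) = f x).image f).card =
      ∑ e ∈ D.image f,
        if e ∈ (D.filter fun x => σ x ∈ D ∧ f (σ x) = f x).image f then 1 else 0 := by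
    rw [← Finset.sum_filter, Finset.filter_mem_eq_inter, Finset.inter_eq_right.2 hsub,
      Finset.card_eq_sum_ones]
  rw [h1, Finset.card_eq_sum_ones, ← Finset.sum_add_distrib]
  -- Fibre by fibre: `{x}` is counted by the first image only, `{x, σ x}` by both.
  refine Finset.sum_congr rfl fun e he => ?_
  obtain ⟨x, hx, rfl⟩ := Finset.mem_image.1 he
  by_cases hd : σ x ∈ D ∧ f (σ x) = f x
  · rw [if_pos (Finset.mem_image.2 ⟨x, Finset.mem_filter.2 ⟨hx, hd⟩, rfl⟩)]
    have : (D.filter fun y => f y = f x) = {x, σ x} := by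
      ext y
      simp only [Finset.mem_filter, Finset.mem_insert, Finset.mem_singleton]
      constructor
      · exact fun h => hf x hx y h.1 h.2.symm
      · rintro (rfl | rfl)
        exacts [⟨hx, rfl⟩, hd]
    rw [this, Finset.card_pair (hσ x hx).symm]
  · rw [if_neg]
    · have : (D.filter fun y => f y = f x) = {x} := by
        ext y
        simp only [Finset.mem_filter, Finset.mem_singleton]
        constructor
        · intro h
          rcases hf x hx y h.1 h.2.symm with rfl | rfl
          exacts [rfl, absurd h hd]
        · rintro rfl
          exact ⟨hx, rfl⟩
      rw [this, Finset.card_singleton]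
    · intro h
      obtain ⟨y, hy, hyx⟩ := Finset.mem_image.1 h
      obtain ⟨hyD, hσy, hfy⟩ := Finset.mem_filter.1 hy
      rcases hf x hx y hyD hyx.symm with rfl | rfl
      · exact hd ⟨hσy, hfy⟩
      · exact hd ⟨hyD, hyx⟩

/-- The ordered pairs whose far ray belongs to the order-`k` diagram. -/
def pairsOfOrder {n : ℕ} (K : Fin n → Fin n → Finset (Fin n)) (k : ℕ) : Finset (Fin n × Fin n) :=
  {x | x.1 ≠ x.2 ∧ (K x.1 x.2).card + 1 = k}

/-- `farEdge` maps the pairs of order `k` onto the unbounded edges, with fibres inside the orbits of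
the swap. The fibres of size two are the edges counted twice. -/
lemma FarStructure.numUnboundedEdges_eq {n : ℕ} {s : Fin n → Set Plane} {R : ℝ}
    {m w : Fin n → Fin n → Plane} {K : Fin n → Fin n → Finset (Fin n)}
    (hF : FarStructure (fun i x => Metric.infDist x (s i)) R m w K) (k : ℕ) :
    numUnboundedEdges s k = (pairsOfOrder K k).card := by
  classical
  have hmem : ∀ x : Fin n × Fin n, x ∈ pairsOfOrder K k ↔
      x.1 ≠ x.2 ∧ (K x.1 x.2).card + 1 = k := fun x => by simp [pairsOfOrder]
  set f : Fin n × Fin n → Set Plane := fun x => farEdge s R m w K x.1 x.2 with hf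
  have h1 : {e ∈ edges s k | ¬ IsBounded e} = ((pairsOfOrder K k).image f : Set (Set Plane)) := by
    ext e
    simp only [Set.mem_ofPred_eq, Finset.coe_image, Set.mem_image, Finset.mem_coe, hmem]
    constructor
    · rintro ⟨he, hb⟩
      obtain ⟨x, hx, hR⟩ := exists_lt_norm_of_not_isBounded hb R
      obtain ⟨i, j, hij, hk, rfl, -⟩ := hF.exists_eq_farEdge he hx hR
      exact ⟨(i, j), ⟨hij, hk⟩, rfl⟩
    · rintro ⟨⟨i, j⟩, ⟨hij, rfl⟩, rfl⟩
      exact ⟨hF.farEdge_mem_edges hij, hF.not_isBounded_farEdge hij⟩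
  have h2 : {e ∈ edges s k | UnboundedInBothDirections e} =
      (((pairsOfOrder K k).filter fun x => x.swap ∈ pairsOfOrder K k ∧ f x.swap = f x).image f :
        Set (Set Plane)) := by
    ext e
    simp only [Set.mem_ofPred_eq, Finset.coe_image, Set.mem_image, Finset.coe_filter, hmem,
      Prod.fst_swap, Prod.snd_swap]
    constructor
    · rintro ⟨he, hb⟩
      obtain ⟨x, hx, hR⟩ : ∃ x ∈ e, R < ‖x‖ := by
        obtain ⟨x, -, y, -, -, -, -, hy, -⟩ := hb
        obtain ⟨z, hz, hR⟩ := exists_lt_norm_of_not_isBounded hy R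
        exact ⟨z, (connectedComponentIn_subset _ _ hz).1, hR⟩
      obtain ⟨i, j, hij, hk, rfl, -⟩ := hF.exists_eq_farEdge he hx hR
      obtain ⟨h3, h4⟩ := (hF.unboundedInBothDirections_farEdge_iff hij).1 hb
      exact ⟨(i, j), ⟨⟨hij, hk⟩, ⟨hij.symm, by rw [← hk]; exact congrArg (· + 1) h3⟩, h4⟩, rfl⟩
    · rintro ⟨⟨i, j⟩, ⟨⟨hij, rfl⟩, ⟨-, h3⟩, h4⟩, rfl⟩
      exact ⟨hF.farEdge_mem_edges hij,
        (hF.unboundedInBothDirections_farEdge_iff hij).2 ⟨Nat.succ_injective h3, h4⟩⟩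
  rw [numUnboundedEdges, h1, h2, Set.encard_coe_eq_coe_finsetCard, Set.encard_coe_eq_coe_finsetCard,
    ← Nat.cast_add, card_image_add_card_image_filter]
  · rintro ⟨i, j⟩ hx h
    exact ((hmem _).1 hx).1 (congrArg Prod.fst h).symm
  · rintro ⟨i, j⟩ hx ⟨i', j'⟩ hy h
    obtain ⟨h3, h4⟩ := (hmem _).1 hx
    obtain ⟨h5, h6⟩ := (hmem _).1 hy
    rcases hF.farEdge_inj h3 h5 (Nat.succ_injective (h4.trans h6.symm)) h with ⟨rfl, rfl⟩ | ⟨rfl, rfl⟩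
    exacts [.inl rfl, .inr rfl]

/-- As `K i j` omits both `i` and `j`, `|K i j| + 1` is at most `n - 1`, so every ordered pair is
counted in exactly one summand. -/
lemma FarStructure.sum_card_pairsOfOrder {n : ℕ} {d : Fin n → Plane → ℝ} {R : ℝ}
    {m w : Fin n → Fin n → Plane} {K : Fin n → Fin n → Finset (Fin n)}
    (hF : FarStructure d R m w K) :
    ∑ k ∈ Finset.Icc 1 (n - 1), (pairsOfOrder K k).card = n * (n - 1) := by
  classical
  have hmaps : ∀ x ∈ (Finset.univ : Finset (Fin n)).offDiag,
      (K x.1 x.2).card + 1 ∈ Finset.Icc 1 (n - 1) := by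
    rintro ⟨i, j⟩ hx
    have hij : i ≠ j := (Finset.mem_offDiag.1 hx).2.2
    have h1 := Finset.card_le_univ (insert i (insert j (K i j)))
    rw [Finset.card_insert_of_notMem, Finset.card_insert_of_notMem (hF.right_notMem i j hij),
      Fintype.card_fin] at h1
    · simp only [Finset.mem_Icc]
      omega
    · simp [hij, hF.left_notMem i j hij]
  have h := Finset.card_eq_sum_card_fiberwise hmaps
  rw [Finset.offDiag_card, Finset.card_univ, Fintype.card_fin] at h
  rw [Nat.mul_sub, mul_one, h]
  refine Finset.sum_congr rfl fun k _ => congrArg _ ?_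
  ext x
  simp [pairsOfOrder]

end SegVoronoi

theorem mainTheorem11 (n : ℕ) (a b : Fin n → SegVoronoi.Plane)
    (hdisj : SegVoronoi.DisjointSites (SegVoronoi.sites a b))
    (hline : SegVoronoi.NoThreeEndpointsCollinear a b)
    (hcircle : SegVoronoi.NoFourSitesOnCircle (SegVoronoi.sites a b)) :
    ∑ k ∈ Finset.Icc 1 (n - 1), SegVoronoi.numUnboundedEdges (SegVoronoi.sites a b) k
      = ((n * (n - 1) : ℕ) : ℕ∞) := by
  obtain ⟨R, m, w, K, hF⟩ := SegVoronoi.exists_farStructure hdisj hline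
  simp only [hF.numUnboundedEdges_eq]
  rw [← hF.sum_card_pairsOfOrder, Nat.cast_sum]
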